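/- Let $(\mathcal N_x,g_x)$ and $(\mathcal N_y,g_y)$ be smooth Riemannian manifolds of dimensions $n_x$ and $n_y$, and give $\mathcal N_x\times\mathcal N_y$ the product metric. For a point $a$ of a Riemannian manifold let $\log_a$ denote the Riemannian logarithm, i.e. the inverse of the exponential map $\exp_a$ on its maximal definition domain (the points reached by minimizing geodesics from $a$ strictly before the cut locus). Let $\mathbf x$ and $\mathbf y$ (the predicted state and the predicted measurement) be random points of $\mathcal N_x$ and $\mathcal N_y$ on a common probability space, with Riemannian means $\hat x$ and $\hat y$ (that is, $\hat x$ minimizes $p\mapsto\mathbb E\,\mathrm{dist}(p,\mathbf x)^2$, which is finite for every $p$, and similarly $\hat y$), and let $y_k\in\mathcal N_y$ be the acquired measurement. Assume that $\log_{\hat x}\mathbf x$ and $\log_{\hat y}\mathbf y$ are almost surely defined and have finite second moments, and that $\log_{\hat y}y_k$ is defined. Tangent vectors are written as columns in fixed bases of the tangent spaces, and the tangent space of the product at $c=(c_x,c_y)$ has the concatenated basis. Put $$P_{xx}=\mathbb E\{(\log_{\hat x}\mathbf x-\log_{\hat x}\hat x)(\log_{\hat x}\mathbf x-\log_{\hat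 x}\hat x)^T\},\quad P_{yy}=\mathbb E\{(\log_{\hat y}\mathbf y-\log_{\hat y}\hat y)(\log_{\hat y}\mathbf y-\log_{\hat y}\hat y)^T\},$$ $$P_{xy}=\mathbb E\{(\log_{\hat x}\mathbf x-\log_{\hat x}\hat x)(\log_{\hat y}\mathbf y-\log_{\hat y}\hat y)^T\},$$ assume that $P_{yy}$ is invertible, and let $G_k=P_{xy}P_{yy}^{-1}$. For chosen points $c=(c_x,c_y)\in\mathcal N_x\times\mathcal N_y$, $b_x\in\mathcal N_x$, $b_y\in\mathcal N_y$ put $\xi=\log_c(\mathbf x,b_y)-\log_c(\hat x,b_y)$ and $\eta=\log_c(b_x,\mathbf y)-\log_c(b_x,\hat y)$, let $P_{xx,**}=\mathbb E\{\xi\xi^T\}$, $P_{yy,**}=\mathbb E\{\eta\eta^T\}$, $P_{xy,**}=\mathbb E\{\xi\eta^T\}$, and define the gain, the corrected mean and the corrected covariance on the product manifold by $$G_{k,**}=P_{xy,**}\,\mathrm{diag}\Big(0_{n_x\times n_x},\ \mathbb E\{(\log_{c_y}\mathbf y-\log_{c_y}\hat y)(\log_{c_y}\mathbf y-\log_{c_y}\hat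 y)^T\}^{-1}\Big),$$ $$\bar x_{**}=\log_c(\hat x,b_y)+G_{k,**}\big(\log_c(b_x,y_k)-\log_c(b_x,\hat y)\big),\qquad P_{**}=P_{xx,**}-G_{k,**}P_{yy,**}G_{k,**}^T .$$ Let the corrected tangent state $x^{TM}_{k|k}$ be the column of the first $n_x$ entries of $\bar x_{**}$, and the corrected tangent covariance $P^{k|k,\hat x}_{xx}$ the upper left $n_x\times n_x$ block of $P_{**}$. If $c_x=b_x=\hat x$ and $c_y=b_y=\hat y$, then $$G_{k,**}=\begin{pmatrix}0&G_k\\0&0\end{pmatrix},\qquad \bar x_{**}=\begin{pmatrix}G_k\log_{\hat y}(y_k)\\0\end{pmatrix},\qquad P_{**}=\begin{pmatrix}P_{xx}-G_kP_{yy}G_k^T&0\\0&0\end{pmatrix};$$ in particular $$x^{TM}_{k|k}=G_k\log_{\hat y}(y_k)=G_k\big(\log_{\hat y}(y_k)-\log_{\hat y}(\hat y)\big),\qquad P^{k|k,\hat x}_{xx}=P_{xx}-G_kP_{yy}G_k^T,$$ so the gain, mean and covariance equations of the single-manifold correction remain valid for states and measurements on different manifolds. -/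

import Mathlib

open Set MeasureTheory Bundle Module
open scoped Manifold ContDiff ENNReal Matrix

noncomputable section

namespace RiemannianKalman

section Manifold

variable {E : Type*} [NormedAddCommGroup E] [NormedSpace ℝ E]
  {H : Type*} [TopologicalSpace H] {I : ModelWithCorners ℝ E H}
  {M : Type*} [TopologicalSpace M] [ChartedSpace H M]

/-- The arc length of the curve `γ` between the times `s` and `t`, for the metric `g`. -/
def arcLength [IsManifold I 1 M] (g : RiemannianMetric (fun p : M => TangentSpace I p))
    (γ : ℝ → M) (s t : ℝ) : ℝ≥0∞ :=
  letI : RiemannianBundle (fun p : M => TangentSpace I p) := ⟨g⟩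
  Manifold.pathELength I γ s t

/-- The Riemannian distance of the metric `g`: the infimum of the arc lengths of the `C^1` curves
between two points. -/
def riemDist [IsManifold I 1 M] (g : RiemannianMetric (fun p : M => TangentSpace I p))
    (p q : M) : ℝ≥0∞ :=
  letI : RiemannianBundle (fun p : M => TangentSpace I p) := ⟨g⟩
  Manifold.riemannianEDist I p q

/-- The metric `g` in the chart `φ` around `p₀`: for `y` in the range of the chart and coordinate
vectors `u`, `v`, the inner product of the tangent vectors `d(φ⁻¹)_y u` and `d(φ⁻¹)_y v`. -/
def coordMetric [IsManifold I 1 M] (g : RiemannianMetric (fun p : M => TangentSpace I p))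
    (p₀ : M) (y u v : E) : ℝ :=
  g.inner ((extChartAt I p₀).symm y)
    (mfderiv 𝓘(ℝ, E) I (extChartAt I p₀).symm y u)
    (mfderiv 𝓘(ℝ, E) I (extChartAt I p₀).symm y v)

/-- The Christoffel symbols of the first kind of the Levi-Civita connection of `g` in the chart
around `p₀`, that is `⟨∇_u v, w⟩` for constant coordinate fields `u`, `v`, `w`. -/
def christoffel [IsManifold I 1 M] (g : RiemannianMetric (fun p : M => TangentSpace I p))
    (p₀ : M) (y u v w : E) : ℝ :=
  (fderiv ℝ (fun z => coordMetric g p₀ z v w) y u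
    + fderiv ℝ (fun z => coordMetric g p₀ z u w) y v
    - fderiv ℝ (fun z => coordMetric g p₀ z u v) y w) / 2

/-- `γ` is a geodesic at time `t`: it is twice continuously differentiable there and its covariant
acceleration `D/dt γ'` vanishes. With `c` the expression of `γ` in the chart around `γ t`, the
inner product of `D/dt γ'` with the coordinate vector `w` is `⟨c'', w⟩ + Γ(c', c'; w)`. -/
def IsGeodesicAt [IsManifold I 1 M] (g : RiemannianMetric (fun p : M => TangentSpace I p))
    (γ : ℝ → M) (t : ℝ) : Prop :=
  ContMDiffAt 𝓘(ℝ, ℝ) I 2 γ t ∧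
  ∀ w : E,
    let c : ℝ → E := fun s => extChartAt I (γ t) (γ s)
    coordMetric g (γ t) (c t) (deriv (deriv c) t) w
      + christoffel g (γ t) (c t) (deriv c t) (deriv c t) w = 0

/-- `v` lies in the maximal definition domain of the exponential map at `a`, and `exp_a v = b`:
there is a geodesic `γ`, on an open interval containing `[0, 1]`, with `γ 0 = a`, `γ' 0 = v` and
`γ 1 = b`, which minimizes the arc length from `a` up to some time later than `1` (so that `b` is
reached strictly before the cut locus of `a`). -/
def IsLog [IsManifold I 1 M] (g : RiemannianMetric (fun p : M => TangentSpace I p))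
    (a b : M) (v : TangentSpace I a) : Prop :=
  ∃ (γ : ℝ → M) (ε : ℝ), 0 < ε ∧
    (∀ t ∈ Ioo (-ε) (1 + ε), IsGeodesicAt g γ t) ∧
    (⟨γ 0, mfderiv 𝓘(ℝ, ℝ) I γ 0 (1 : ℝ)⟩ : TangentBundle I M) = ⟨a, v⟩ ∧
    γ 1 = b ∧
    ∀ t ∈ Ico 0 (1 + ε), arcLength g γ 0 t = riemDist g a (γ t)

/-- The points at which the logarithm `log_a` is defined. -/
def logDomain [IsManifold I 1 M] (g : RiemannianMetric (fun p : M => TangentSpace I p))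
    (a : M) : Set M :=
  {b | ∃! v : TangentSpace I a, IsLog g a b v}

open Classical in
/-- The Riemannian logarithm `log_a b`, the inverse of the exponential map at `a` on its maximal
definition domain (with value `0` where it is not defined). -/
def riemLog [IsManifold I 1 M] (g : RiemannianMetric (fun p : M => TangentSpace I p))
    (a b : M) : TangentSpace I a :=
  if h : ∃! v : TangentSpace I a, IsLog g a b v then h.choose else 0

/-- The variance of the random point `X` with respect to the point `p`. -/
def variance [IsManifold I 1 M] {Ω : Type*} [MeasurableSpace Ω]
    (g : RiemannianMetric (fun p : M => TangentSpace I p)) (P : Measure Ω) (X : Ω → M) (p : M) :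
    ℝ≥0∞ :=
  ∫⁻ o, riemDist g p (X o) ^ 2 ∂P

/-- `m` is a Riemannian (Karcher) mean of the random point `X`: the variance of `X` is finite with
respect to every point, and minimal with respect to `m`. -/
def IsMean [IsManifold I 1 M] {Ω : Type*} [MeasurableSpace Ω]
    (g : RiemannianMetric (fun p : M => TangentSpace I p)) (P : Measure Ω) (X : Ω → M) (m : M) :
    Prop :=
  (∀ p, variance g P X p < ⊤) ∧ ∀ p, variance g P X m ≤ variance g P X p

/-- The column of coordinates of `log_a b` in the basis `β` of the tangent space at `a`. -/
def logCoord [IsManifold I 1 M] {ι : Type*}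
    (g : RiemannianMetric (fun p : M => TangentSpace I p))
    {a : M} (β : Basis ι ℝ (TangentSpace I a)) (b : M) : ι → ℝ :=
  fun i => β.repr (riemLog g a b) i

end Manifold

section Two

variable {E : Type*} [NormedAddCommGroup E] [NormedSpace ℝ E]
  {H : Type*} [TopologicalSpace H] {I : ModelWithCorners ℝ E H}
  {M : Type*} [TopologicalSpace M] [ChartedSpace H M] [IsManifold I 1 M]
  {E' : Type*} [NormedAddCommGroup E'] [NormedSpace ℝ E']
  {H' : Type*} [TopologicalSpace H'] {J : ModelWithCorners ℝ E' H'}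
  {N : Type*} [TopologicalSpace N] [ChartedSpace H' N] [IsManifold J 1 N]

/-- The cross-covariance matrix of the random points `X` and `Y` with respect to the points `mX`
and `mY`, at the points `a` and `b`, in bases of the tangent spaces there:
`E{(log_a X - log_a mX) (log_b Y - log_b mY)ᵀ}`. -/
def crossCov {Ω : Type*} [MeasurableSpace Ω] {ι κ : Type*}
    (g : RiemannianMetric (fun p : M => TangentSpace I p))
    (h : RiemannianMetric (fun q : N => TangentSpace J q))
    {a : M} (β : Basis ι ℝ (TangentSpace I a)) {b : N} (β' : Basis κ ℝ (TangentSpace J b))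
    (P : Measure Ω) (X : Ω → M) (mX : M) (Y : Ω → N) (mY : N) : Matrix ι κ ℝ :=
  Matrix.of fun i j =>
    ∫ o, (logCoord g β (X o) - logCoord g β mX) i * (logCoord h β' (Y o) - logCoord h β' mY) j ∂P

/-- The product metric on `M × N`. -/
def prodMetric (g : RiemannianMetric (fun p : M => TangentSpace I p))
    (h : RiemannianMetric (fun q : N => TangentSpace J q)) :
    RiemannianMetric (fun c : M × N => TangentSpace (I.prod J) c) where
  inner c :=
    let G : E →L[ℝ] E →L[ℝ] ℝ := g.inner c.1
    let K : E' →L[ℝ] E' →L[ℝ] ℝ := h.inner c.2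
    (G.bilinearComp (.fst ℝ E E') (.fst ℝ E E') + K.bilinearComp (.snd ℝ E E') (.snd ℝ E E') :
      (E × E') →L[ℝ] (E × E') →L[ℝ] ℝ)
  symm c v w := congrArg₂ (· + ·) (g.symm c.1 v.1 w.1) (h.symm c.2 v.2 w.2)
  pos c v hv := by
    have nonneg₁ : ∀ u : TangentSpace I c.1, 0 ≤ g.inner c.1 u u := fun u => by
      by_cases hu : u = 0
      · simp [hu]
      · exact (g.pos c.1 u hu).le
    have nonneg₂ : ∀ u : TangentSpace J c.2, 0 ≤ h.inner c.2 u u := fun u => by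
      by_cases hu : u = 0
      · simp [hu]
      · exact (h.pos c.2 u hu).le
    change 0 < g.inner c.1 v.1 v.1 + h.inner c.2 v.2 v.2
    by_cases h1 : (show TangentSpace I c.1 from v.1) = 0
    · have h2 : (show TangentSpace J c.2 from v.2) ≠ 0 := fun h2 => hv (Prod.ext h1 h2)
      exact add_pos_of_nonneg_of_pos (nonneg₁ v.1) (h.pos c.2 v.2 h2)
    · exact add_pos_of_pos_of_nonneg (g.pos c.1 v.1 h1) (nonneg₂ v.2)
  continuousAt c := by
    have h1 : Continuous fun v : E × E' =>
        (show E →L[ℝ] E →L[ℝ] ℝ from g.inner c.1) v.1 v.1 := by fun_prop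
    have h2 : Continuous fun v : E × E' =>
        (show E' →L[ℝ] E' →L[ℝ] ℝ from h.inner c.2) v.2 v.2 := by fun_prop
    exact (h1.add h2).continuousAt
  isVonNBounded c := by
    have nonneg₁ : ∀ u : TangentSpace I c.1, 0 ≤ g.inner c.1 u u := fun u => by
      by_cases hu : u = 0
      · simp [hu]
      · exact (g.pos c.1 u hu).le
    have nonneg₂ : ∀ u : TangentSpace J c.2, 0 ≤ h.inner c.2 u u := fun u => by
      by_cases hu : u = 0
      · simp [hu]
      · exact (h.pos c.2 u hu).le
    have b1 : Bornology.IsBounded {u : E | g.inner c.1 u u < 1} :=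
      (NormedSpace.isVonNBounded_iff ℝ).1 (g.isVonNBounded c.1)
    have b2 : Bornology.IsBounded {u : E' | h.inner c.2 u u < 1} :=
      (NormedSpace.isVonNBounded_iff ℝ).1 (h.isVonNBounded c.2)
    refine (NormedSpace.isVonNBounded_iff ℝ (E := E × E')).2 ((b1.prod b2).subset ?_)
    intro v hv
    have hv' : g.inner c.1 v.1 v.1 + h.inner c.2 v.2 v.2 < 1 := hv
    exact ⟨lt_of_le_of_lt (le_add_of_nonneg_right (nonneg₂ v.2)) hv',
      lt_of_le_of_lt (le_add_of_nonneg_left (nonneg₁ v.1)) hv'⟩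

/-- The basis of the tangent space of `M × N` at `(a, b)` which is the concatenation of bases of
the tangent spaces of `M` at `a` and of `N` at `b`. -/
def prodBasis {ι κ : Type*} {a : M} (β : Basis ι ℝ (TangentSpace I a))
    {b : N} (β' : Basis κ ℝ (TangentSpace J b)) :
    Basis (ι ⊕ κ) ℝ (TangentSpace (I.prod J) ((a, b) : M × N)) :=
  (β.prod β' : Basis (ι ⊕ κ) ℝ (TangentSpace I a × TangentSpace J b))

/-! The correction on the product manifold. The arguments are the two metrics, bases `β`, `β'` of the
tangent spaces at the components of the base point `c = (c_x, c_y)`, the points `b_x`, `b_y`, the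
law `P`, the predicted state `X` and measurement `Y` (random points on a common probability space),
and their means `mX`, `mY`. -/

variable {Ω : Type*} [MeasurableSpace Ω] {ι κ : Type*}
  (g : RiemannianMetric (fun p : M => TangentSpace I p))
  (h : RiemannianMetric (fun q : N => TangentSpace J q))
  {cx : M} (β : Basis ι ℝ (TangentSpace I cx)) {cy : N} (β' : Basis κ ℝ (TangentSpace J cy))
  (bX : M) (bY : N) (P : Measure Ω) (X : Ω → M) (mX : M) (Y : Ω → N) (mY : N)

/-- The state covariance on the product: the covariance at `c` of `(X, b_y)` with respect to
`(mX, b_y)`. -/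
def prodCovXX : Matrix (ι ⊕ κ) (ι ⊕ κ) ℝ :=
  crossCov (prodMetric g h) (prodMetric g h) (prodBasis β β') (prodBasis β β') P
    (fun o => (X o, bY)) (mX, bY) (fun o => (X o, bY)) (mX, bY)

/-- The measurement covariance on the product: the covariance at `c` of `(b_x, Y)` with respect to
`(b_x, mY)`. -/
def prodCovYY : Matrix (ι ⊕ κ) (ι ⊕ κ) ℝ :=
  crossCov (prodMetric g h) (prodMetric g h) (prodBasis β β') (prodBasis β β') P
    (fun o => (bX, Y o)) (bX, mY) (fun o => (bX, Y o)) (bX, mY)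

/-- The cross-covariance on the product of `(X, b_y)` and `(b_x, Y)` at `c`. -/
def prodCovXY : Matrix (ι ⊕ κ) (ι ⊕ κ) ℝ :=
  crossCov (prodMetric g h) (prodMetric g h) (prodBasis β β') (prodBasis β β') P
    (fun o => (X o, bY)) (mX, bY) (fun o => (bX, Y o)) (bX, mY)

/-- The gain on the product:
`P_{xy,**} diag(0, E{(log_{c_y} Y - log_{c_y} mY)(log_{c_y} Y - log_{c_y} mY)ᵀ}⁻¹)`. -/
def prodGain [Fintype ι] [Fintype κ] [DecidableEq κ] : Matrix (ι ⊕ κ) (ι ⊕ κ) ℝ :=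
  prodCovXY g h β β' bX bY P X mX Y mY *
    Matrix.fromBlocks 0 0 0 (crossCov h h β' β' P Y mY Y mY)⁻¹

/-- The corrected mean on the product, for the acquired measurement `y`:
`log_c (mX, b_y) + G_** (log_c (b_x, y) - log_c (b_x, mY))`. -/
def prodCorrectedMean [Fintype ι] [Fintype κ] [DecidableEq κ] (y : N) : ι ⊕ κ → ℝ :=
  logCoord (prodMetric g h) (prodBasis β β') (mX, bY) +
    prodGain g h β β' bX bY P X mX Y mY *ᵥ
      (logCoord (prodMetric g h) (prodBasis β β') (bX, y) -
        logCoord (prodMetric g h) (prodBasis β β') (bX, mY))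

/-- The corrected covariance on the product: `P_{xx,**} - G_** P_{yy,**} G_**ᵀ`. -/
def prodCorrectedCov [Fintype ι] [Fintype κ] [DecidableEq κ] : Matrix (ι ⊕ κ) (ι ⊕ κ) ℝ :=
  prodCovXX g h β β' bY P X mX -
    prodGain g h β β' bX bY P X mX Y mY * prodCovYY g h β β' bX P Y mY *
      (prodGain g h β β' bX bY P X mX Y mY)ᵀ

/-- The corrected tangent state: the state block of the corrected mean on the product. -/
def correctedTangentState [Fintype ι] [Fintype κ] [DecidableEq κ] (y : N) : ι → ℝ :=
  fun i => prodCorrectedMean g h β β' bX bY P X mX Y mY y (Sum.inl i)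

/-- The corrected tangent covariance: the state block of the corrected covariance on the
product. -/
def correctedTangentCov [Fintype ι] [Fintype κ] [DecidableEq κ] : Matrix ι ι ℝ :=
  (prodCorrectedCov g h β β' bX bY P X mX Y mY).toBlocks₁₁

end Two

end RiemannianKalman

end

noncomputable section

namespace RiemannianKalman

/-! ### Speed, arc length and distance on one manifold. -/

section Manifold

variable {E : Type*} [NormedAddCommGroup E] [NormedSpace ℝ E]
  {H : Type*} [TopologicalSpace H] {I : ModelWithCorners ℝ E H}
  {M : Type*} [TopologicalSpace M] [ChartedSpace H M]

/-! At the means, every product logarithm in the correction joins two points of one slice: `(xhat,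
yhat)` to a point `(p, yhat)` or `(xhat, q)`. Everything therefore rests on `log_(a,b) (p, b) =
(log_a p, 0)` and its mirror image (`riemLog_prod_left`, `riemLog_prod_right`). After that each
covariance has a single nonzero block, and what remains is block multiplication.

In product charts the metric is block diagonal and each block depends on its own variable only, so
the geodesic equation decouples (`isGeodesicAt_prod_iff`). Geodesics have constant speed
(`IsGeodesicAt.hasDerivAt_speedSq`), so a product geodesic whose components have squared speeds `s`
and `r` has length `√(s + r)` on `[0, 1]`. If it minimizes from `(a, b)` to `(p, b)`, this length is
the distance from `a` to `p` (`riemDist_prod_left`), which is at most the length `√s` of the first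
component. Hence `r = 0` and the second component of the velocity vanishes. At all times up to `1 +
ε` the triangle bound `riemDist_prod_le` then passes minimality to the first component, because the
second has length zero. Conversely, a minimizing geodesic of a factor paired with a constant curve
minimizes in the product.

This gives an equivalence of `IsLog` statements (`isLog_prod_left_iff`, `isLog_prod_right_iff`), so
existence and uniqueness of the logarithm transfer together. The Pythagorean formula for the product
distance is not needed. -/

theorem metric_inner_self_nonneg [IsManifold I 1 M]
    (g : RiemannianMetric (fun p : M => TangentSpace I p)) (p : M) (u : TangentSpace I p) :
    0 ≤ g.inner p u u := by
  by_cases hu : u = 0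
  · simp [hu]
  · exact (g.pos p u hu).le

/-- The squared speed of the curve `γ` at time `t`. -/
def speedSq [IsManifold I 1 M] (g : RiemannianMetric (fun p : M => TangentSpace I p))
    (γ : ℝ → M) (t : ℝ) : ℝ :=
  g.inner (γ t) (mfderiv 𝓘(ℝ, ℝ) I γ t (1 : ℝ)) (mfderiv 𝓘(ℝ, ℝ) I γ t (1 : ℝ))

theorem speedSq_nonneg [IsManifold I 1 M] (g : RiemannianMetric (fun p : M => TangentSpace I p))
    (γ : ℝ → M) (t : ℝ) : 0 ≤ speedSq g γ t :=
  metric_inner_self_nonneg g _ _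

theorem arcLength_eq_lintegral [IsManifold I 1 M]
    (g : RiemannianMetric (fun p : M => TangentSpace I p)) (γ : ℝ → M) (s t : ℝ) :
    arcLength g γ s t = ∫⁻ r in Icc s t, ENNReal.ofReal (√(speedSq g γ r)) := by
  let : RiemannianBundle (fun p : M => TangentSpace I p) := ⟨g⟩
  change Manifold.pathELength I γ s t = _
  rw [Manifold.pathELength_eq_lintegral_mfderiv_Icc]
  refine lintegral_congr fun r => ?_
  rw [← ofReal_norm]
  rfl

theorem riemDist_self [IsManifold I 1 M]
    (g : RiemannianMetric (fun p : M => TangentSpace I p)) (p : M) : riemDist g p p = 0 := by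
  let : RiemannianBundle (fun p : M => TangentSpace I p) := ⟨g⟩
  exact Manifold.riemannianEDist_self

theorem riemDist_triangle [IsManifold I 1 M]
    (g : RiemannianMetric (fun p : M => TangentSpace I p)) (p q r : M) :
    riemDist g p r ≤ riemDist g p q + riemDist g q r := by
  let : RiemannianBundle (fun p : M => TangentSpace I p) := ⟨g⟩
  exact Manifold.riemannianEDist_triangle

theorem riemDist_le_arcLength [IsManifold I 1 M]
    (g : RiemannianMetric (fun p : M => TangentSpace I p)) {γ : ℝ → M} {s t : ℝ}
    (hγ : ContMDiffOn 𝓘(ℝ, ℝ) I 1 γ (Icc s t)) (hst : s ≤ t) :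
    riemDist g (γ s) (γ t) ≤ arcLength g γ s t := by
  let : RiemannianBundle (fun p : M => TangentSpace I p) := ⟨g⟩
  exact Manifold.riemannianEDist_le_pathELength hγ rfl rfl hst

theorem exists_arcLength_lt_of_riemDist_lt [IsManifold I 1 M]
    (g : RiemannianMetric (fun p : M => TangentSpace I p)) {p q : M} {r : ℝ≥0∞}
    (h : riemDist g p q < r) :
    ∃ γ : ℝ → M, γ 0 = p ∧ γ 1 = q ∧ ContMDiff 𝓘(ℝ, ℝ) I 1 γ ∧ arcLength g γ 0 1 < r := by
  let : RiemannianBundle (fun p : M => TangentSpace I p) := ⟨g⟩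
  obtain ⟨γ, h0, h1, hγ, hlt, -, -⟩ :=
    Manifold.exists_lt_locally_constant_of_riemannianEDist_lt (I := I) h zero_lt_one
  exact ⟨γ, h0, h1, hγ, hlt⟩

/-! ### The metric in a chart. -/

/-- The tangent map of the inverse chart is `C^1` into the tangent bundle, and the metric pairs two
`C^1` maps over the same base map to a `C^1` function. Differentiability is joint because along a
curve the base point and both velocity slots move together. -/
theorem differentiableAt_coordMetric [I.Boundaryless] [IsManifold I ∞ M]
    (g : ContMDiffRiemannianMetric I ∞ E (fun p : M => TangentSpace I p)) (p₀ : M) {y : E}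
    (hy : y ∈ (extChartAt I p₀).target) (u v : E) :
    DifferentiableAt ℝ
      (fun z : E × E × E => coordMetric g.toRiemannianMetric p₀ z.1 z.2.1 z.2.2) (y, u, v) := by
  let : RiemannianBundle (fun p : M => TangentSpace I p) := ⟨g.toRiemannianMetric⟩
  have hopen := isOpen_extChartAt_target (I := I) p₀
  have h1 : ContMDiffOn 𝓘(ℝ, E).tangent I.tangent 1
      (tangentMapWithin 𝓘(ℝ, E) I (extChartAt I p₀).symm (extChartAt I p₀).target)
      (π E (TangentSpace 𝓘(ℝ, E)) ⁻¹' (extChartAt I p₀).target) :=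
    (contMDiffOn_extChartAt_symm (n := ∞) p₀).contMDiffOn_tangentMapWithin (by norm_cast)
      hopen.uniqueMDiffOn
  have key : ∀ (L : E × E × E → E), ContDiff ℝ 1 L →
      ContMDiffAt 𝓘(ℝ, E × E × E) I.tangent 1
        (fun z : E × E × E => (⟨(extChartAt I p₀).symm z.1,
          mfderiv 𝓘(ℝ, E) I (extChartAt I p₀).symm z.1 (L z)⟩ : TangentBundle I M)) (y, u, v) := by
    intro L hL
    have hz : ContMDiffAt 𝓘(ℝ, E × E × E) 𝓘(ℝ, E).tangent 1
        (fun z : E × E × E => (⟨z.1, L z⟩ : TangentBundle 𝓘(ℝ, E) E)) (y, u, v) := by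
      rw [contMDiffAt_totalSpace]
      refine ⟨contDiff_fst.contMDiff.contMDiffAt, ?_⟩
      simpa using hL.contMDiff.contMDiffAt
    have hnhds : (π E (TangentSpace 𝓘(ℝ, E)) ⁻¹' (extChartAt I p₀).target) ∈
        nhds (⟨y, L (y, u, v)⟩ : TangentBundle 𝓘(ℝ, E) E) :=
      (hopen.preimage (FiberBundle.continuous_proj E (TangentSpace 𝓘(ℝ, E)))).mem_nhds hy
    refine ((h1.contMDiffAt hnhds).comp (y, u, v) hz).congr_of_eventuallyEq ?_
    filter_upwards [(hopen.preimage continuous_fst).mem_nhds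
      (show (y, u, v) ∈ Prod.fst ⁻¹' (extChartAt I p₀).target from hy)] with z hz'
    -- On the open chart target the derivative within the target is the full derivative.
    simp only [Function.comp_apply, tangentMapWithin]
    rw [mfderivWithin_of_isOpen hopen hz']
  have hd := ContMDiffAt.inner_bundle (IB := I) (n := 1) (F := E)
    (E := fun p : M => TangentSpace I p)
    (key (fun z => z.2.1) (by fun_prop)) (key (fun z => z.2.2) (by fun_prop))
  exact (hd.contDiffAt).differentiableAt (by simp)

theorem coordMetric_comm [IsManifold I 1 M]
    (g : RiemannianMetric (fun p : M => TangentSpace I p)) (p₀ : M) (y u v : E) :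
    coordMetric g p₀ y u v = coordMetric g p₀ y v u :=
  g.symm _ _ _

/-- The bilinear form `coordMetric g p₀ y` on the model space. -/
def coordMetricCLM [IsManifold I 1 M]
    (g : RiemannianMetric (fun p : M => TangentSpace I p)) (p₀ : M) (y : E) : E →L[ℝ] E →L[ℝ] ℝ :=
  let G : E →L[ℝ] E →L[ℝ] ℝ := g.inner ((extChartAt I p₀).symm y)
  let D : E →L[ℝ] E := mfderiv 𝓘(ℝ, E) I (extChartAt I p₀).symm y
  G.bilinearComp D D

theorem coordMetricCLM_apply [IsManifold I 1 M]
    (g : RiemannianMetric (fun p : M => TangentSpace I p)) (p₀ : M) (y u v : E) :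
    coordMetricCLM g p₀ y u v = coordMetric g p₀ y u v :=
  rfl

theorem contDiffAt_extChartAt_comp [IsManifold I ∞ M] {γ : ℝ → M} {t : ℝ}
    (hγ : ContMDiffAt 𝓘(ℝ, ℝ) I 2 γ t) :
    ContDiffAt ℝ 2 (fun s => extChartAt I (γ t) (γ s)) t :=
  ((contMDiffAt_extChartAt (n := 2)).comp t hγ).contDiffAt

theorem eventually_mdifferentiableAt [IsManifold I 1 M] {γ : ℝ → M} {t : ℝ}
    (hγ : ContMDiffAt 𝓘(ℝ, ℝ) I 2 γ t) :
    ∀ᶠ s in nhds t, MDifferentiableAt 𝓘(ℝ, ℝ) I γ s := by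
  have h := (contMDiffAt_iff_contMDiffAt_nhds (n := 1) (by simp)).1 (hγ.of_le one_le_two)
  filter_upwards [h] with s hs using hs.mdifferentiableAt one_ne_zero

/-- All tangent spaces are the model space by definition, so vectors can be compared there while the
base point changes; this avoids transport along `p = q`. -/
theorem metric_inner_congr [IsManifold I 1 M]
    (g : RiemannianMetric (fun p : M => TangentSpace I p)) {p q : M} (h : p = q) {u v u' v' : E}
    (hu : u = u') (hv : v = v') :
    g.inner p (show TangentSpace I p from u) (show TangentSpace I p from v) =
      g.inner q (show TangentSpace I q from u') (show TangentSpace I q from v') := by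
  subst h hu hv
  rfl

/-- Near `s` the curve is the inverse chart composed with its coordinate expression; apply the chain
rule. -/
theorem speedSq_eq_coordMetric [I.Boundaryless] [IsManifold I ∞ M]
    (g : RiemannianMetric (fun p : M => TangentSpace I p)) {γ : ℝ → M} (p₀ : M) {s : ℝ}
    (hγ : MDifferentiableAt 𝓘(ℝ, ℝ) I γ s) (hs : γ s ∈ (extChartAt I p₀).source) :
    speedSq g γ s = coordMetric g p₀ (extChartAt I p₀ (γ s))
      (deriv (fun r => extChartAt I p₀ (γ r)) s) (deriv (fun r => extChartAt I p₀ (γ r)) s) := by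
  have hD : MDifferentiableAt 𝓘(ℝ, E) I (extChartAt I p₀).symm (extChartAt I p₀ (γ s)) :=
    ((contMDiffOn_extChartAt_symm (n := 1) p₀).contMDiffAt
      ((isOpen_extChartAt_target p₀).mem_nhds ((extChartAt I p₀).map_source hs))).mdifferentiableAt
        one_ne_zero
  have hc : MDifferentiableAt 𝓘(ℝ, ℝ) 𝓘(ℝ, E) (fun r => extChartAt I p₀ (γ r)) s :=
    (mdifferentiableAt_extChartAt (by simpa using hs)).comp s hγ
  have hev : γ =ᶠ[nhds s] (extChartAt I p₀).symm ∘ (fun r => extChartAt I p₀ (γ r)) := by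
    filter_upwards [hγ.continuousAt.preimage_mem_nhds
      ((isOpen_extChartAt_source p₀).mem_nhds hs)] with r hr
    exact ((extChartAt I p₀).left_inv hr).symm
  have hmf : (mfderiv 𝓘(ℝ, ℝ) I γ s (1 : ℝ) : E) =
      (mfderiv 𝓘(ℝ, E) I (extChartAt I p₀).symm (extChartAt I p₀ (γ s)) : E →L[ℝ] E)
        (deriv (fun r => extChartAt I p₀ (γ r)) s) := by
    have h1 : (mfderiv 𝓘(ℝ, ℝ) I γ s : ℝ →L[ℝ] E) = _ := hev.mfderiv_eq
    rw [h1, mfderiv_comp s hD hc, mfderiv_eq_fderiv]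
    rfl
  exact metric_inner_congr g ((extChartAt I p₀).left_inv hs).symm hmf hmf

/-! ### Geodesics have constant speed. -/

theorem christoffel_self [IsManifold I 1 M]
    (g : RiemannianMetric (fun p : M => TangentSpace I p)) (p₀ : M) (y u : E) :
    christoffel g p₀ y u u u = fderiv ℝ (fun z => coordMetric g p₀ z u u) y u / 2 := by
  unfold christoffel
  ring

/-- The derivative of the coordinate metric in the base point and both vector arguments. -/
theorem fderiv_coordMetric_apply [I.Boundaryless] [IsManifold I ∞ M]
    (g : ContMDiffRiemannianMetric I ∞ E (fun p : M => TangentSpace I p)) (p₀ : M) {y : E}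
    (hy : y ∈ (extChartAt I p₀).target) (u v w₁ w₂ w₃ : E) :
    fderiv ℝ (fun z : E × E × E => coordMetric g.toRiemannianMetric p₀ z.1 z.2.1 z.2.2) (y, u, v)
        (w₁, w₂, w₃) =
      fderiv ℝ (fun z => coordMetric g.toRiemannianMetric p₀ z u v) y w₁ +
        coordMetric g.toRiemannianMetric p₀ y w₂ v + coordMetric g.toRiemannianMetric p₀ y u w₃ := by
  -- The three partial derivatives come from freezing two slots. In the vector slots `F` is linear,
  -- hence its own derivative.
  set F := fun z : E × E × E => coordMetric g.toRiemannianMetric p₀ z.1 z.2.1 z.2.2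
  have hF : HasFDerivAt F (fderiv ℝ F (y, u, v)) (y, u, v) :=
    (differentiableAt_coordMetric g p₀ hy u v).hasFDerivAt
  have e1 : fderiv ℝ F (y, u, v) (w₁, 0, 0) =
      fderiv ℝ (fun z => coordMetric g.toRiemannianMetric p₀ z u v) y w₁ := by
    have := (HasFDerivAt.comp (f := fun z : E => (z, u, v)) y hF
      ((hasFDerivAt_id y).prodMk (hasFDerivAt_const (u, v) y))).fderiv
    exact (congrArg (fun L : E →L[ℝ] ℝ => L w₁) this).symm
  have e2 : fderiv ℝ F (y, u, v) (0, w₂, 0) = coordMetric g.toRiemannianMetric p₀ y w₂ v := by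
    have h := HasFDerivAt.comp (f := fun z : E => (y, z, v)) u hF ((hasFDerivAt_const y u).prodMk
      ((hasFDerivAt_id u).prodMk (hasFDerivAt_const v u)))
    have h' := ((coordMetricCLM g.toRiemannianMetric p₀ y).flip v).hasFDerivAt (x := u)
    exact congrArg (fun L : E →L[ℝ] ℝ => L w₂) (h.unique h')
  have e3 : fderiv ℝ F (y, u, v) (0, 0, w₃) = coordMetric g.toRiemannianMetric p₀ y u w₃ := by
    have h := HasFDerivAt.comp (f := fun z : E => (y, u, z)) v hF ((hasFDerivAt_const y v).prodMk
      ((hasFDerivAt_const u v).prodMk (hasFDerivAt_id v)))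
    have h' := (coordMetricCLM g.toRiemannianMetric p₀ y u).hasFDerivAt (x := v)
    exact congrArg (fun L : E →L[ℝ] ℝ => L w₃) (h.unique h')
  rw [← e1, ← e2, ← e3, ← map_add, ← map_add]
  simp

/-- In coordinates the derivative of `g(c', c')` is `(∂_{c'} g)(c', c') + 2 g(c'', c')`, which is
twice the geodesic expression tested against `c'`. -/
theorem IsGeodesicAt.hasDerivAt_speedSq [I.Boundaryless] [IsManifold I ∞ M]
    {g : ContMDiffRiemannianMetric I ∞ E (fun p : M => TangentSpace I p)} {γ : ℝ → M} {t : ℝ}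
    (hγ : IsGeodesicAt g.toRiemannianMetric γ t) :
    HasDerivAt (speedSq g.toRiemannianMetric γ) 0 t := by
  obtain ⟨hsm, hgeo⟩ := hγ
  set p₀ := γ t with hp₀
  set c : ℝ → E := fun s => extChartAt I p₀ (γ s) with hc
  have hc2 : ContDiffAt ℝ 2 c t := contDiffAt_extChartAt_comp hsm
  have hc1 : HasDerivAt c (deriv c t) t := (hc2.differentiableAt (by simp)).hasDerivAt
  have hc' : HasDerivAt (deriv c) (deriv (deriv c) t) t := 
    ((hc2.derivWithin (m := 1) (by norm_num)).differentiableAt one_ne_zero).hasDerivAt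
  have hy : c t ∈ (extChartAt I p₀).target := mem_extChartAt_target p₀
  have hd := (differentiableAt_coordMetric g p₀ hy (deriv c t) (deriv c t)).hasFDerivAt
    |>.comp_hasDerivAt t (hc1.prodMk (hc'.prodMk hc'))
  have hev : speedSq g.toRiemannianMetric γ =ᶠ[nhds t]
      fun s => coordMetric g.toRiemannianMetric p₀ (c s) (deriv c s) (deriv c s) := by
    filter_upwards [hsm.continuousAt.preimage_mem_nhds (extChartAt_source_mem_nhds (I := I) p₀),
      eventually_mdifferentiableAt hsm] with s hs hs'
    exact speedSq_eq_coordMetric _ p₀ hs' hs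
  refine HasDerivAt.congr_of_eventuallyEq ?_ hev
  refine hd.congr_deriv ?_
  have h : coordMetric g.toRiemannianMetric p₀ (c t) (deriv (deriv c) t) (deriv c t) +
    christoffel g.toRiemannianMetric p₀ (c t) (deriv c t) (deriv c t) (deriv c t) = 0 :=
    hgeo (deriv c t)
  rw [christoffel_self] at h
  rw [fderiv_coordMetric_apply g p₀ hy, coordMetric_comm _ _ _ (deriv c t) (deriv (deriv c) t)]
  linarith

theorem speedSq_eq_of_isGeodesicAt [I.Boundaryless] [IsManifold I ∞ M]
    {g : ContMDiffRiemannianMetric I ∞ E (fun p : M => TangentSpace I p)} {γ : ℝ → M} {a b : ℝ}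
    (hγ : ∀ t ∈ Ioo a b, IsGeodesicAt g.toRiemannianMetric γ t) {s t : ℝ} (hs : s ∈ Ioo a b)
    (ht : t ∈ Ioo a b) :
    speedSq g.toRiemannianMetric γ s = speedSq g.toRiemannianMetric γ t :=
  isOpen_Ioo.is_const_of_deriv_eq_zero isPreconnected_Ioo
    (fun r hr => (hγ r hr).hasDerivAt_speedSq.differentiableAt.differentiableWithinAt)
    (fun r hr => (hγ r hr).hasDerivAt_speedSq.deriv) hs ht

theorem arcLength_eq_of_speedSq_eq [IsManifold I 1 M]
    {g : RiemannianMetric (fun p : M => TangentSpace I p)} {γ : ℝ → M} {t k : ℝ}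
    (hk : ∀ r ∈ Icc 0 t, speedSq g γ r = k) :
    arcLength g γ 0 t = ENNReal.ofReal (√k * t) := by
  rw [arcLength_eq_lintegral, setLIntegral_congr_fun (g := fun _ => ENNReal.ofReal (√k))
    measurableSet_Icc (fun r hr => by simp only [hk r hr]), setLIntegral_const,
    Real.volume_Icc, sub_zero, ENNReal.ofReal_mul (Real.sqrt_nonneg _)]

theorem speedSq_eq_speedSq_zero [I.Boundaryless] [IsManifold I ∞ M]
    {g : ContMDiffRiemannianMetric I ∞ E (fun p : M => TangentSpace I p)} {γ : ℝ → M} {ε t : ℝ}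
    (hε : 0 < ε) (hγ : ∀ t ∈ Ioo (-ε) (1 + ε), IsGeodesicAt g.toRiemannianMetric γ t)
    (ht : t ∈ Ico 0 (1 + ε)) :
    ∀ r ∈ Icc 0 t, speedSq g.toRiemannianMetric γ r = speedSq g.toRiemannianMetric γ 0 := by
  intro r hr
  exact speedSq_eq_of_isGeodesicAt hγ ⟨by linarith [hr.1], hr.2.trans_lt ht.2⟩
    ⟨by linarith, by linarith⟩

theorem arcLength_eq_of_isGeodesicAt [I.Boundaryless] [IsManifold I ∞ M]
    {g : ContMDiffRiemannianMetric I ∞ E (fun p : M => TangentSpace I p)} {γ : ℝ → M} {ε t : ℝ}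
    (hε : 0 < ε) (hγ : ∀ t ∈ Ioo (-ε) (1 + ε), IsGeodesicAt g.toRiemannianMetric γ t)
    (ht : t ∈ Ico 0 (1 + ε)) :
    arcLength g.toRiemannianMetric γ 0 t =
      ENNReal.ofReal (√(speedSq g.toRiemannianMetric γ 0) * t) :=
  arcLength_eq_of_speedSq_eq (speedSq_eq_speedSq_zero hε hγ ht)

/-! ### Constant curves and the logarithm at its base point. -/

theorem mfderiv_const_curve (a : M) (t : ℝ) :
    mfderiv 𝓘(ℝ, ℝ) I (fun _ : ℝ => a) t (1 : ℝ) = 0 := by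
  rw [mfderiv_const]
  rfl

theorem speedSq_const [IsManifold I 1 M]
    (g : RiemannianMetric (fun p : M => TangentSpace I p)) (a : M) (t : ℝ) :
    speedSq g (fun _ => a) t = 0 := by
  rw [speedSq, mfderiv_const_curve, map_zero]

theorem arcLength_const [IsManifold I 1 M]
    (g : RiemannianMetric (fun p : M => TangentSpace I p)) (a : M) (s t : ℝ) :
    arcLength g (fun _ => a) s t = 0 := by
  simp [arcLength_eq_lintegral, speedSq_const]

theorem isGeodesicAt_const [IsManifold I 1 M]
    (g : RiemannianMetric (fun p : M => TangentSpace I p)) (a : M) (t : ℝ) :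
    IsGeodesicAt g (fun _ => a) t := by
  refine ⟨contMDiffAt_const, fun w => ?_⟩
  have h0 : ∀ y v : E, coordMetric g a y 0 v = 0 := fun y v => by
    rw [← coordMetricCLM_apply, map_zero]
    rfl
  simp [christoffel, h0]

theorem eq_zero_of_metric_inner_self [IsManifold I 1 M]
    (g : RiemannianMetric (fun p : M => TangentSpace I p)) {p : M} {u : TangentSpace I p}
    (h : g.inner p u u = 0) : u = 0 := by
  by_contra hu
  exact (g.pos p u hu).ne' h

/-- A curve with initial velocity `v` and vanishing initial speed has `v = 0`. -/
theorem eq_zero_of_speedSq_eq_zero [IsManifold I 1 M]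
    {g : RiemannianMetric (fun p : M => TangentSpace I p)} {γ : ℝ → M} {a : M}
    {v : TangentSpace I a}
    (hv : (⟨γ 0, mfderiv 𝓘(ℝ, ℝ) I γ 0 (1 : ℝ)⟩ : TangentBundle I M) = ⟨a, v⟩)
    (h0 : speedSq g γ 0 = 0) : v = 0 := by
  rw [eq_zero_of_metric_inner_self _ h0] at hv
  cases hv
  rfl

/-- A geodesic that minimizes from `a` back to `a` has length zero on `[0, 1]`; its speed is
constant, so its initial velocity is zero. -/
theorem isLog_self_iff [I.Boundaryless] [IsManifold I ∞ M]
    (g : ContMDiffRiemannianMetric I ∞ E (fun p : M => TangentSpace I p)) (a : M)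
    (v : TangentSpace I a) :
    IsLog g.toRiemannianMetric a a v ↔ v = 0 := by
  constructor
  · rintro ⟨γ, ε, hε, hγ, hv, h1, hlen⟩
    have h := hlen 1 ⟨zero_le_one, by linarith⟩
    rw [arcLength_eq_of_isGeodesicAt hε hγ ⟨zero_le_one, by linarith⟩, h1, riemDist_self, mul_one,
      ENNReal.ofReal_eq_zero] at h
    have h' : speedSq g.toRiemannianMetric γ 0 = 0 :=
      (Real.sqrt_eq_zero (speedSq_nonneg _ _ _)).1 (le_antisymm h (Real.sqrt_nonneg _))
    exact eq_zero_of_speedSq_eq_zero hv h'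
  · rintro rfl
    refine ⟨fun _ => a, 1, one_pos, fun t _ => isGeodesicAt_const _ a t, ?_, rfl, fun t _ => ?_⟩
    · rw [mfderiv_const_curve]
    · rw [arcLength_const, riemDist_self]

/-- The hypothesis packs existence and uniqueness into one equivalence, so logarithms on the product
can be found by chaining equivalences. -/
theorem riemLog_eq_of_isLog_iff [IsManifold I 1 M]
    {g : RiemannianMetric (fun p : M => TangentSpace I p)} {a b : M} {v : TangentSpace I a}
    (h : ∀ u, IsLog g a b u ↔ u = v) : riemLog g a b = v := by
  have h' : ∃! u : TangentSpace I a, IsLog g a b u := ⟨v, (h v).2 rfl, fun u hu => (h u).1 hu⟩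
  rw [riemLog, dif_pos h']
  exact (h _).1 h'.choose_spec.1

theorem isLog_iff_eq_riemLog [IsManifold I 1 M]
    {g : RiemannianMetric (fun p : M => TangentSpace I p)} {a b : M} (hb : b ∈ logDomain g a)
    (u : TangentSpace I a) : IsLog g a b u ↔ u = riemLog g a b := by
  obtain ⟨v, hv, huniq⟩ := id hb
  have h : ∀ u, IsLog g a b u ↔ u = v := fun u => ⟨huniq u, fun hu => hu ▸ hv⟩
  rw [riemLog_eq_of_isLog_iff h, h]

theorem riemLog_self [I.Boundaryless] [IsManifold I ∞ M]
    (g : ContMDiffRiemannianMetric I ∞ E (fun p : M => TangentSpace I p)) (a : M) :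
    riemLog g.toRiemannianMetric a a = 0 :=
  riemLog_eq_of_isLog_iff (isLog_self_iff g a)

theorem IsGeodesicAt.mdifferentiableAt [IsManifold I 1 M]
    {g : RiemannianMetric (fun p : M => TangentSpace I p)}
    {γ : ℝ → M} {t : ℝ} (hγ : IsGeodesicAt g γ t) : MDifferentiableAt 𝓘(ℝ, ℝ) I γ t :=
  hγ.1.mdifferentiableAt (by simp)

theorem riemDist_le_arcLength_of_isGeodesicAt [IsManifold I 1 M]
    {g : RiemannianMetric (fun p : M => TangentSpace I p)} {γ : ℝ → M} {ε t : ℝ} (hε : 0 < ε)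
    (hγ : ∀ t ∈ Ioo (-ε) (1 + ε), IsGeodesicAt g γ t) (ht : t ∈ Ico 0 (1 + ε)) :
    riemDist g (γ 0) (γ t) ≤ arcLength g γ 0 t :=
  riemDist_le_arcLength g (fun r hr => ((hγ r ⟨by linarith [hr.1], hr.2.trans_lt ht.2⟩).1.of_le
    one_le_two).contMDiffWithinAt) ht.1

end Manifold


/-! ### Curves, lengths and distances in a product. -/

section Two

variable {E : Type*} [NormedAddCommGroup E] [NormedSpace ℝ E]
  {H : Type*} [TopologicalSpace H] {I : ModelWithCorners ℝ E H}
  {M : Type*} [TopologicalSpace M] [ChartedSpace H M]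
  {E' : Type*} [NormedAddCommGroup E'] [NormedSpace ℝ E']
  {H' : Type*} [TopologicalSpace H'] {J : ModelWithCorners ℝ E' H'}
  {N : Type*} [TopologicalSpace N] [ChartedSpace H' N]

/-- Initial conditions are equalities in the total space, since the starting point is only
propositionally the prescribed one; this splits them into components. -/
theorem tangentBundle_prod_ext_iff {p a : M} {q b : N} {u : TangentSpace I p}
    {w : TangentSpace J q} {v : TangentSpace (I.prod J) ((a, b) : M × N)} :
    (⟨(p, q), (u, w)⟩ : TangentBundle (I.prod J) (M × N)) = ⟨(a, b), v⟩ ↔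
      (⟨p, u⟩ : TangentBundle I M) = ⟨a, v.1⟩ ∧ (⟨q, w⟩ : TangentBundle J N) = ⟨b, v.2⟩ := by
  constructor
  · intro h
    cases h
    exact ⟨rfl, rfl⟩
  · obtain ⟨v₁, v₂⟩ := v
    rintro ⟨h₁, h₂⟩
    cases h₁
    cases h₂
    rfl

theorem velocity_prod_eq_iff {γ₁ : ℝ → M} {γ₂ : ℝ → N} {a : M} {b : N}
    {v : TangentSpace (I.prod J) ((a, b) : M × N)} (h₁ : MDifferentiableAt 𝓘(ℝ, ℝ) I γ₁ 0)
    (h₂ : MDifferentiableAt 𝓘(ℝ, ℝ) J γ₂ 0) :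
    (⟨(γ₁ 0, γ₂ 0), mfderiv 𝓘(ℝ, ℝ) (I.prod J) (fun s => (γ₁ s, γ₂ s)) 0 (1 : ℝ)⟩ :
        TangentBundle (I.prod J) (M × N)) = ⟨(a, b), v⟩ ↔
      (⟨γ₁ 0, mfderiv 𝓘(ℝ, ℝ) I γ₁ 0 (1 : ℝ)⟩ : TangentBundle I M) = ⟨a, v.1⟩ ∧
        (⟨γ₂ 0, mfderiv 𝓘(ℝ, ℝ) J γ₂ 0 (1 : ℝ)⟩ : TangentBundle J N) = ⟨b, v.2⟩ := by
  rw [mfderiv_prodMk h₁ h₂]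
  exact tangentBundle_prod_ext_iff (u := mfderiv 𝓘(ℝ, ℝ) I γ₁ 0 (1 : ℝ))
    (w := mfderiv 𝓘(ℝ, ℝ) J γ₂ 0 (1 : ℝ))

theorem eq_zero_of_sqrt_add_le {s r : ℝ} (hs : 0 ≤ s) (hr : 0 ≤ r) (hle : √(s + r) ≤ √s) :
    r = 0 := by
  have := (Real.sqrt_le_sqrt_iff hs).1 hle
  linarith

/-- Makes the geodesic expression of one factor drop out when the product equation is tested against
`(w, 0)` or `(0, w)`. -/
theorem coordMetric_add_christoffel_zero [IsManifold I 1 M]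
    (g : RiemannianMetric (fun p : M => TangentSpace I p)) (p : M) (y u v : E) :
    coordMetric g p y u 0 + christoffel g p y v v 0 = 0 := by
  have h0 : ∀ z u : E, coordMetric g p z u 0 = 0 := fun z u => by
    rw [← coordMetricCLM_apply, map_zero]
  simp [christoffel, h0]

section LowRegularity

variable [IsManifold I 1 M] [IsManifold J 1 N]
  (g : RiemannianMetric (fun p : M => TangentSpace I p))
  (h : RiemannianMetric (fun q : N => TangentSpace J q))

theorem speedSq_prod {γ₁ : ℝ → M} {γ₂ : ℝ → N} {t : ℝ}
    (h₁ : MDifferentiableAt 𝓘(ℝ, ℝ) I γ₁ t) (h₂ : MDifferentiableAt 𝓘(ℝ, ℝ) J γ₂ t) :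
    speedSq (prodMetric g h) (fun s => (γ₁ s, γ₂ s)) t = speedSq g γ₁ t + speedSq h γ₂ t := by
  rw [speedSq, mfderiv_prodMk h₁ h₂]
  rfl

theorem arcLength_fst_le {γ₁ : ℝ → M} {γ₂ : ℝ → N} {s t : ℝ}
    (h₁ : ∀ r ∈ Icc s t, MDifferentiableAt 𝓘(ℝ, ℝ) I γ₁ r)
    (h₂ : ∀ r ∈ Icc s t, MDifferentiableAt 𝓘(ℝ, ℝ) J γ₂ r) :
    arcLength g γ₁ s t ≤ arcLength (prodMetric g h) (fun s => (γ₁ s, γ₂ s)) s t := by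
  simp only [arcLength_eq_lintegral]
  refine setLIntegral_mono' measurableSet_Icc fun r hr => ENNReal.ofReal_le_ofReal ?_
  rw [speedSq_prod g h (h₁ r hr) (h₂ r hr)]
  exact Real.sqrt_le_sqrt (le_add_of_nonneg_right (speedSq_nonneg h γ₂ r))

theorem arcLength_snd_le {γ₁ : ℝ → M} {γ₂ : ℝ → N} {s t : ℝ}
    (h₁ : ∀ r ∈ Icc s t, MDifferentiableAt 𝓘(ℝ, ℝ) I γ₁ r)
    (h₂ : ∀ r ∈ Icc s t, MDifferentiableAt 𝓘(ℝ, ℝ) J γ₂ r) :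
    arcLength h γ₂ s t ≤ arcLength (prodMetric g h) (fun s => (γ₁ s, γ₂ s)) s t := by
  simp only [arcLength_eq_lintegral]
  refine setLIntegral_mono' measurableSet_Icc fun r hr => ENNReal.ofReal_le_ofReal ?_
  rw [speedSq_prod g h (h₁ r hr) (h₂ r hr)]
  exact Real.sqrt_le_sqrt (le_add_of_nonneg_left (speedSq_nonneg g γ₁ r))

theorem arcLength_prod_const {γ : ℝ → M} (b : N) {s t : ℝ}
    (hγ : ∀ r ∈ Icc s t, MDifferentiableAt 𝓘(ℝ, ℝ) I γ r) :
    arcLength (prodMetric g h) (fun s => (γ s, b)) s t = arcLength g γ s t := by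
  simp only [arcLength_eq_lintegral]
  refine setLIntegral_congr_fun measurableSet_Icc fun r hr => ?_
  simp only [speedSq_prod g h (hγ r hr) (mdifferentiableAt_const (c := b)), speedSq_const, add_zero]

theorem arcLength_const_prod (a : M) {γ : ℝ → N} {s t : ℝ}
    (hγ : ∀ r ∈ Icc s t, MDifferentiableAt 𝓘(ℝ, ℝ) J γ r) :
    arcLength (prodMetric g h) (fun s => (a, γ s)) s t = arcLength h γ s t := by
  simp only [arcLength_eq_lintegral]
  refine setLIntegral_congr_fun measurableSet_Icc fun r hr => ?_
  simp only [speedSq_prod g h (mdifferentiableAt_const (c := a)) (hγ r hr), speedSq_const, zero_add]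

/-- Projecting a curve to a factor does not increase its length. -/
theorem riemDist_fst_le (c d : M × N) : riemDist g c.1 d.1 ≤ riemDist (prodMetric g h) c d := by
  refine le_of_forall_gt fun r hr => ?_
  obtain ⟨γ, rfl, rfl, hγ, hlt⟩ := exists_arcLength_lt_of_riemDist_lt _ hr
  have h₁ : ContMDiff 𝓘(ℝ, ℝ) I 1 (fun t => (γ t).1) := contMDiff_fst.comp hγ
  have h₂ : ContMDiff 𝓘(ℝ, ℝ) J 1 (fun t => (γ t).2) := contMDiff_snd.comp hγ
  refine (riemDist_le_arcLength g h₁.contMDiffOn zero_le_one).trans_lt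
    ((arcLength_fst_le g h (fun r _ => h₁.mdifferentiable one_ne_zero r)
      (fun r _ => h₂.mdifferentiable one_ne_zero r)).trans_lt hlt)

theorem riemDist_snd_le (c d : M × N) : riemDist h c.2 d.2 ≤ riemDist (prodMetric g h) c d := by
  refine le_of_forall_gt fun r hr => ?_
  obtain ⟨γ, rfl, rfl, hγ, hlt⟩ := exists_arcLength_lt_of_riemDist_lt _ hr
  have h₁ : ContMDiff 𝓘(ℝ, ℝ) I 1 (fun t => (γ t).1) := contMDiff_fst.comp hγ
  have h₂ : ContMDiff 𝓘(ℝ, ℝ) J 1 (fun t => (γ t).2) := contMDiff_snd.comp hγ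
  refine (riemDist_le_arcLength h h₂.contMDiffOn zero_le_one).trans_lt
    ((arcLength_snd_le g h (fun r _ => h₁.mdifferentiable one_ne_zero r)
      (fun r _ => h₂.mdifferentiable one_ne_zero r)).trans_lt hlt)

/-- Projection gives one inequality; pairing nearly minimizing curves of the factor with the
constant `b` gives the other. -/
theorem riemDist_prod_left (a p : M) (b : N) :
    riemDist (prodMetric g h) (a, b) (p, b) = riemDist g a p := by
  refine le_antisymm (le_of_forall_gt fun r hr => ?_) (riemDist_fst_le g h (a, b) (p, b))
  obtain ⟨γ, rfl, rfl, hγ, hlt⟩ := exists_arcLength_lt_of_riemDist_lt _ hr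
  refine (riemDist_le_arcLength (prodMetric g h) (γ := fun t => (γ t, b))
    (hγ.prodMk contMDiff_const).contMDiffOn zero_le_one).trans_lt ?_
  rwa [arcLength_prod_const g h b fun r _ => hγ.mdifferentiable one_ne_zero r]

theorem riemDist_prod_right (a : M) (b q : N) :
    riemDist (prodMetric g h) (a, b) (a, q) = riemDist h b q := by
  refine le_antisymm (le_of_forall_gt fun r hr => ?_) (riemDist_snd_le g h (a, b) (a, q))
  obtain ⟨γ, rfl, rfl, hγ, hlt⟩ := exists_arcLength_lt_of_riemDist_lt _ hr
  refine (riemDist_le_arcLength (prodMetric g h) (γ := fun t => (a, γ t))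
    (contMDiff_const.prodMk hγ).contMDiffOn zero_le_one).trans_lt ?_
  rwa [arcLength_const_prod g h a fun r _ => hγ.mdifferentiable one_ne_zero r]

/-- The distance on the product is at most the sum of the distances of the components. -/
theorem riemDist_prod_le (c d : M × N) :
    riemDist (prodMetric g h) c d ≤ riemDist g c.1 d.1 + riemDist h c.2 d.2 := by
  have := riemDist_triangle (prodMetric g h) c (d.1, c.2) d
  rwa [show c = (c.1, c.2) from rfl, show d = (d.1, d.2) from rfl, riemDist_prod_left,
    riemDist_prod_right] at this

theorem coordMetric_prod [I.Boundaryless] [J.Boundaryless] (p : M × N) {y : E × E'}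
    (hy₁ : y.1 ∈ (extChartAt I p.1).target) (hy₂ : y.2 ∈ (extChartAt J p.2).target)
    (u v : E × E') :
    coordMetric (prodMetric g h) p y u v =
      coordMetric g p.1 y.1 u.1 v.1 + coordMetric h p.2 y.2 u.2 v.2 := by
  have d₁ : MDifferentiableAt 𝓘(ℝ, E) I (extChartAt I p.1).symm y.1 :=
    ((contMDiffOn_extChartAt_symm (n := 1) p.1).contMDiffAt
      ((isOpen_extChartAt_target p.1).mem_nhds hy₁)).mdifferentiableAt one_ne_zero
  have d₂ : MDifferentiableAt 𝓘(ℝ, E') J (extChartAt J p.2).symm y.2 :=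
    ((contMDiffOn_extChartAt_symm (n := 1) p.2).contMDiffAt
      ((isOpen_extChartAt_target p.2).mem_nhds hy₂)).mdifferentiableAt one_ne_zero
  have hD : (mfderiv 𝓘(ℝ, E × E') (I.prod J) (extChartAt (I.prod J) p).symm y :
      E × E' →L[ℝ] E × E') =
      (mfderiv 𝓘(ℝ, E) I (extChartAt I p.1).symm y.1 : E →L[ℝ] E).prodMap
        (mfderiv 𝓘(ℝ, E') J (extChartAt J p.2).symm y.2 : E' →L[ℝ] E') := by
    -- The self-model of `E × E'` has to be seen as a product of models before the derivative of a
    -- product map applies.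
    rw [extChartAt_prod, modelWithCornersSelf_prod, ← chartedSpaceSelf_prod]
    exact mfderiv_prodMap d₁ d₂
  have hp : (extChartAt (I.prod J) p).symm y =
      ((extChartAt I p.1).symm y.1, (extChartAt J p.2).symm y.2) := by
    rw [extChartAt_prod]
    rfl
  exact metric_inner_congr (prodMetric g h) hp (congrArg (fun L : E × E' →L[ℝ] E × E' => L u) hD)
    (congrArg (fun L : E × E' →L[ℝ] E × E' => L v) hD)

end LowRegularity

/-! ### Splitting of the geodesic equation. -/

section Smooth

variable [I.Boundaryless] [J.Boundaryless] [IsManifold I ∞ M] [IsManifold J ∞ N]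
  (g : ContMDiffRiemannianMetric I ∞ E (fun p : M => TangentSpace I p))
  (h : ContMDiffRiemannianMetric J ∞ E' (fun q : N => TangentSpace J q))

theorem differentiableAt_coordMetric_base (p₀ : M) {y : E}
    (hy : y ∈ (extChartAt I p₀).target) (u v : E) :
    DifferentiableAt ℝ (fun z => coordMetric g.toRiemannianMetric p₀ z u v) y :=
  (differentiableAt_coordMetric g p₀ hy u v).comp y (f := fun z : E => (z, u, v))
    (differentiableAt_id.prodMk (differentiableAt_const _))

theorem fderiv_coordMetric_prod (p : M × N) {y : E × E'}
    (hy₁ : y.1 ∈ (extChartAt I p.1).target) (hy₂ : y.2 ∈ (extChartAt J p.2).target)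
    (u v w : E × E') :
    fderiv ℝ (fun z => coordMetric (prodMetric g.toRiemannianMetric h.toRiemannianMetric) p z u v)
        y w =
      fderiv ℝ (fun z => coordMetric g.toRiemannianMetric p.1 z u.1 v.1) y.1 w.1 +
        fderiv ℝ (fun z => coordMetric h.toRiemannianMetric p.2 z u.2 v.2) y.2 w.2 := by
  -- The splitting is available only over the chart targets; as these are open, it holds near `y`,
  -- which suffices for the derivative.
  have hev : (fun z => coordMetric (prodMetric g.toRiemannianMetric h.toRiemannianMetric) p z u v)
      =ᶠ[nhds y] fun z => coordMetric g.toRiemannianMetric p.1 z.1 u.1 v.1 +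
        coordMetric h.toRiemannianMetric p.2 z.2 u.2 v.2 := by
    filter_upwards [continuous_fst.continuousAt.preimage_mem_nhds
        ((isOpen_extChartAt_target p.1).mem_nhds hy₁),
      continuous_snd.continuousAt.preimage_mem_nhds
        ((isOpen_extChartAt_target p.2).mem_nhds hy₂)] with z hz₁ hz₂
    exact coordMetric_prod _ _ p hz₁ hz₂ u v
  have h₁ := (differentiableAt_coordMetric_base g p.1 hy₁ u.1 v.1).hasFDerivAt.comp y
    (hasFDerivAt_fst (p := y) (𝕜 := ℝ))
  have h₂ := (differentiableAt_coordMetric_base h p.2 hy₂ u.2 v.2).hasFDerivAt.comp y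
    (hasFDerivAt_snd (p := y) (𝕜 := ℝ))
  rw [hev.fderiv_eq]
  exact congrArg (fun L : E × E' →L[ℝ] ℝ => L w) (h₁.add h₂).fderiv

theorem christoffel_prod (p : M × N) {y : E × E'}
    (hy₁ : y.1 ∈ (extChartAt I p.1).target) (hy₂ : y.2 ∈ (extChartAt J p.2).target)
    (u v w : E × E') :
    christoffel (prodMetric g.toRiemannianMetric h.toRiemannianMetric) p y u v w =
      christoffel g.toRiemannianMetric p.1 y.1 u.1 v.1 w.1 +
        christoffel h.toRiemannianMetric p.2 y.2 u.2 v.2 w.2 := by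
  simp only [christoffel, fderiv_coordMetric_prod g h p hy₁ hy₂]
  ring

theorem isGeodesicAt_prod_iff {γ₁ : ℝ → M} {γ₂ : ℝ → N} {t : ℝ} :
    IsGeodesicAt (prodMetric g.toRiemannianMetric h.toRiemannianMetric)
        (fun s => (γ₁ s, γ₂ s)) t ↔
      IsGeodesicAt g.toRiemannianMetric γ₁ t ∧ IsGeodesicAt h.toRiemannianMetric γ₂ t := by
  unfold IsGeodesicAt
  rw [contMDiffAt_prod_iff]
  change (ContMDiffAt 𝓘(ℝ, ℝ) I 2 γ₁ t ∧ ContMDiffAt 𝓘(ℝ, ℝ) J 2 γ₂ t) ∧ _ ↔ _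
  -- Once the product expression is the sum of the factor expressions, test vectors supported in one
  -- factor separate the two equations.
  suffices hsuff : ContMDiffAt 𝓘(ℝ, ℝ) I 2 γ₁ t → ContMDiffAt 𝓘(ℝ, ℝ) J 2 γ₂ t → ∀ w : E × E',
      (coordMetric (prodMetric g.toRiemannianMetric h.toRiemannianMetric) (γ₁ t, γ₂ t)
        (extChartAt (I.prod J) (γ₁ t, γ₂ t) (γ₁ t, γ₂ t))
        (deriv (deriv fun s => extChartAt (I.prod J) (γ₁ t, γ₂ t) (γ₁ s, γ₂ s)) t) w
      + christoffel (prodMetric g.toRiemannianMetric h.toRiemannianMetric) (γ₁ t, γ₂ t)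
        (extChartAt (I.prod J) (γ₁ t, γ₂ t) (γ₁ t, γ₂ t))
        (deriv (fun s => extChartAt (I.prod J) (γ₁ t, γ₂ t) (γ₁ s, γ₂ s)) t)
        (deriv (fun s => extChartAt (I.prod J) (γ₁ t, γ₂ t) (γ₁ s, γ₂ s)) t) w) =
      (coordMetric g.toRiemannianMetric (γ₁ t) (extChartAt I (γ₁ t) (γ₁ t))
        (deriv (deriv fun s => extChartAt I (γ₁ t) (γ₁ s)) t) w.1
      + christoffel g.toRiemannianMetric (γ₁ t) (extChartAt I (γ₁ t) (γ₁ t))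
        (deriv (fun s => extChartAt I (γ₁ t) (γ₁ s)) t)
        (deriv (fun s => extChartAt I (γ₁ t) (γ₁ s)) t) w.1) +
      (coordMetric h.toRiemannianMetric (γ₂ t) (extChartAt J (γ₂ t) (γ₂ t))
        (deriv (deriv fun s => extChartAt J (γ₂ t) (γ₂ s)) t) w.2
      + christoffel h.toRiemannianMetric (γ₂ t) (extChartAt J (γ₂ t) (γ₂ t))
        (deriv (fun s => extChartAt J (γ₂ t) (γ₂ s)) t)
        (deriv (fun s => extChartAt J (γ₂ t) (γ₂ s)) t) w.2) by
    have z₁ : ∀ (p : M) (y u v : E), coordMetric g.toRiemannianMetric p y u 0 +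
        christoffel g.toRiemannianMetric p y v v 0 = 0 :=
      fun p y u v => coordMetric_add_christoffel_zero _ p y u v
    have z₂ : ∀ (p : N) (y u v : E'), coordMetric h.toRiemannianMetric p y u 0 +
        christoffel h.toRiemannianMetric p y v v 0 = 0 :=
      fun p y u v => coordMetric_add_christoffel_zero _ p y u v
    constructor
    · rintro ⟨⟨h₁, h₂⟩, hw⟩
      refine ⟨⟨h₁, fun w => ?_⟩, ⟨h₂, fun w => ?_⟩⟩
      · have := (hsuff h₁ h₂ (w, 0)).symm.trans (hw (w, 0))
        rwa [z₂, add_zero] at this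
      · have := (hsuff h₁ h₂ (0, w)).symm.trans (hw (0, w))
        rwa [z₁, zero_add] at this
    · rintro ⟨⟨h₁, hw₁⟩, ⟨h₂, hw₂⟩⟩
      refine ⟨⟨h₁, h₂⟩, fun w => (hsuff h₁ h₂ w).trans ?_⟩
      have e₁ := hw₁ w.1
      have e₂ := hw₂ w.2
      exact (congrArg₂ (· + ·) e₁ e₂).trans (add_zero 0)
  intro h₁ h₂ w
  set c₁ : ℝ → E := fun s => extChartAt I (γ₁ t) (γ₁ s)
  set c₂ : ℝ → E' := fun s => extChartAt J (γ₂ t) (γ₂ s)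
  have hc₁ : ContDiffAt ℝ 2 c₁ t := contDiffAt_extChartAt_comp h₁
  have hc₂ : ContDiffAt ℝ 2 c₂ t := contDiffAt_extChartAt_comp h₂
  have hc : (fun s => extChartAt (I.prod J) (γ₁ t, γ₂ t) (γ₁ s, γ₂ s)) =
      fun s => (c₁ s, c₂ s) := by
    rw [extChartAt_prod]
    rfl
  -- A whole neighbourhood of `t` is needed, since this is differentiated once more.
  have hd : deriv (fun s => (c₁ s, c₂ s)) =ᶠ[nhds t] fun s => (deriv c₁ s, deriv c₂ s) := by
    filter_upwards [hc₁.eventually (by simp), hc₂.eventually (by simp)] with s hs₁ hs₂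
    exact ((hs₁.differentiableAt (by simp)).hasDerivAt.prodMk
      (hs₂.differentiableAt (by simp)).hasDerivAt).deriv
  have hdd : deriv (deriv fun s => (c₁ s, c₂ s)) t = (deriv (deriv c₁) t, deriv (deriv c₂) t) := by
    rw [hd.deriv_eq]
    exact (((hc₁.derivWithin (m := 1) (by norm_num)).differentiableAt one_ne_zero).hasDerivAt.prodMk
      ((hc₂.derivWithin (m := 1) (by norm_num)).differentiableAt one_ne_zero).hasDerivAt).deriv
  rw [hc, hdd, hd.eq_of_nhds, congrFun hc t, coordMetric_prod, christoffel_prod]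
  · ring
  all_goals exact mem_extChartAt_target _

end Smooth

end Two


/-! ### Logarithms along the slices of a product. -/

section Two

variable {E : Type*} [NormedAddCommGroup E] [NormedSpace ℝ E]
  {H : Type*} [TopologicalSpace H] {I : ModelWithCorners ℝ E H}
  {M : Type*} [TopologicalSpace M] [ChartedSpace H M]
  {E' : Type*} [NormedAddCommGroup E'] [NormedSpace ℝ E']
  {H' : Type*} [TopologicalSpace H'] {J : ModelWithCorners ℝ E' H'}
  {N : Type*} [TopologicalSpace N] [ChartedSpace H' N]
  [I.Boundaryless] [J.Boundaryless] [IsManifold I ∞ M] [IsManifold J ∞ N]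
  (g : ContMDiffRiemannianMetric I ∞ E (fun p : M => TangentSpace I p))
  (h : ContMDiffRiemannianMetric J ∞ E' (fun q : N => TangentSpace J q))

theorem arcLength_prod_of_isGeodesicAt {γ₁ : ℝ → M} {γ₂ : ℝ → N} {ε t : ℝ} (hε : 0 < ε)
    (h₁ : ∀ t ∈ Ioo (-ε) (1 + ε), IsGeodesicAt g.toRiemannianMetric γ₁ t)
    (h₂ : ∀ t ∈ Ioo (-ε) (1 + ε), IsGeodesicAt h.toRiemannianMetric γ₂ t)
    (ht : t ∈ Ico 0 (1 + ε)) :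
    arcLength (prodMetric g.toRiemannianMetric h.toRiemannianMetric)
        (fun s => (γ₁ s, γ₂ s)) 0 t =
      ENNReal.ofReal (√(speedSq g.toRiemannianMetric γ₁ 0 + speedSq h.toRiemannianMetric γ₂ 0) *
        t) := by
  refine arcLength_eq_of_speedSq_eq fun r hr => ?_
  have hr' : r ∈ Ioo (-ε) (1 + ε) := ⟨by linarith [hr.1], hr.2.trans_lt ht.2⟩
  rw [speedSq_prod _ _ (h₁ r hr').mdifferentiableAt (h₂ r hr').mdifferentiableAt,
    speedSq_eq_speedSq_zero hε h₁ ht r hr, speedSq_eq_speedSq_zero hε h₂ ht r hr]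

/-- The endpoint in the slice forces the second component of a minimizing geodesic to have speed
zero. -/
theorem isLog_prod_left_iff (a p : M) (b : N)
    (v : TangentSpace (I.prod J) ((a, b) : M × N)) :
    IsLog (prodMetric g.toRiemannianMetric h.toRiemannianMetric) (a, b) (p, b) v ↔
      IsLog g.toRiemannianMetric a p v.1 ∧ v.2 = 0 := by
  constructor
  · rintro ⟨γ, ε, hε, hγ, hv, h1, hlen⟩
    obtain ⟨γ₁, γ₂, rfl⟩ : ∃ (γ₁ : ℝ → M) (γ₂ : ℝ → N), γ = fun s => (γ₁ s, γ₂ s) :=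
      ⟨fun s => (γ s).1, fun s => (γ s).2, rfl⟩
    have hg₁ := fun t ht => ((isGeodesicAt_prod_iff g h).1 (hγ t ht)).1
    have hg₂ := fun t ht => ((isGeodesicAt_prod_iff g h).1 (hγ t ht)).2
    have h0 : (0 : ℝ) ∈ Ioo (-ε) (1 + ε) := ⟨by linarith, by linarith⟩
    have hone : (1 : ℝ) ∈ Ico 0 (1 + ε) := ⟨zero_le_one, by linarith⟩
    obtain ⟨hv₁, hv₂⟩ :=
      (velocity_prod_eq_iff (hg₁ 0 h0).mdifferentiableAt (hg₂ 0 h0).mdifferentiableAt).1 hv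
    have ha : γ₁ 0 = a := congrArg TotalSpace.proj hv₁
    have hb : γ₂ 0 = b := congrArg TotalSpace.proj hv₂
    have hp : γ₁ 1 = p := congrArg Prod.fst h1
    -- At time `1`, `√(s + r)` equals the distance from `a` to `p`, which is at most the length `√s`
    -- of `γ₁`.
    have hs : speedSq h.toRiemannianMetric γ₂ 0 = 0 := by
      have hle := hlen 1 hone
      rw [h1, riemDist_prod_left, ← ha, ← hp] at hle
      have hle' := hle.trans_le (riemDist_le_arcLength_of_isGeodesicAt hε hg₁ hone)
      rw [arcLength_prod_of_isGeodesicAt g h hε hg₁ hg₂ hone,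
        arcLength_eq_of_isGeodesicAt hε hg₁ hone, mul_one, mul_one,
        ENNReal.ofReal_le_ofReal_iff (Real.sqrt_nonneg _)] at hle'
      exact eq_zero_of_sqrt_add_le (speedSq_nonneg _ _ _) (speedSq_nonneg _ _ _) hle'
    refine ⟨⟨γ₁, ε, hε, hg₁, hv₁, hp, fun t ht => le_antisymm ?_ ?_⟩,
      eq_zero_of_speedSq_eq_zero hv₂ hs⟩
    -- The product distance exceeds that of the first components by at most the length of `γ₂`,
    -- which is zero; constancy of `γ₂` is not required.
    · have hle := (hlen t ht).trans_le (riemDist_prod_le _ _ _ _)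
      rw [arcLength_prod_of_isGeodesicAt g h hε hg₁ hg₂ ht, hs, add_zero,
        ← arcLength_eq_of_isGeodesicAt hε hg₁ ht, ← hb] at hle
      refine hle.trans ((add_le_add_right
        (riemDist_le_arcLength_of_isGeodesicAt hε hg₂ ht) _).trans_eq ?_)
      simp [arcLength_eq_of_isGeodesicAt hε hg₂ ht, hs]
    · rw [← ha]
      exact riemDist_le_arcLength_of_isGeodesicAt hε hg₁ ht
  · rintro ⟨⟨γ, ε, hε, hγ, hv, h1, hlen⟩, hv₂⟩
    have h0 : (0 : ℝ) ∈ Ioo (-ε) (1 + ε) := ⟨by linarith, by linarith⟩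
    refine ⟨fun s => (γ s, b), ε, hε,
      fun t ht => (isGeodesicAt_prod_iff g h).2 ⟨hγ t ht, isGeodesicAt_const _ b t⟩, ?_, ?_, ?_⟩
    · refine (velocity_prod_eq_iff (γ₂ := fun _ => b) (hγ 0 h0).mdifferentiableAt
        mdifferentiableAt_const).2 ⟨hv, ?_⟩
      rw [mfderiv_const_curve, hv₂]
      rfl
    · exact congrArg (fun r => (r, b)) h1
    · intro t ht
      rw [arcLength_prod_const _ _ b fun r hr =>
        (hγ r ⟨by linarith [hr.1], hr.2.trans_lt ht.2⟩).mdifferentiableAt, riemDist_prod_left]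
      exact hlen t ht

theorem isLog_prod_right_iff (a : M) (b q : N)
    (v : TangentSpace (I.prod J) ((a, b) : M × N)) :
    IsLog (prodMetric g.toRiemannianMetric h.toRiemannianMetric) (a, b) (a, q) v ↔
      v.1 = 0 ∧ IsLog h.toRiemannianMetric b q v.2 := by
  constructor
  · rintro ⟨γ, ε, hε, hγ, hv, h1, hlen⟩
    obtain ⟨γ₁, γ₂, rfl⟩ : ∃ (γ₁ : ℝ → M) (γ₂ : ℝ → N), γ = fun s => (γ₁ s, γ₂ s) :=
      ⟨fun s => (γ s).1, fun s => (γ s).2, rfl⟩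
    have hg₁ := fun t ht => ((isGeodesicAt_prod_iff g h).1 (hγ t ht)).1
    have hg₂ := fun t ht => ((isGeodesicAt_prod_iff g h).1 (hγ t ht)).2
    have h0 : (0 : ℝ) ∈ Ioo (-ε) (1 + ε) := ⟨by linarith, by linarith⟩
    have hone : (1 : ℝ) ∈ Ico 0 (1 + ε) := ⟨zero_le_one, by linarith⟩
    obtain ⟨hv₁, hv₂⟩ :=
      (velocity_prod_eq_iff (hg₁ 0 h0).mdifferentiableAt (hg₂ 0 h0).mdifferentiableAt).1 hv
    have ha : γ₁ 0 = a := congrArg TotalSpace.proj hv₁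
    have hb : γ₂ 0 = b := congrArg TotalSpace.proj hv₂
    have hq : γ₂ 1 = q := congrArg Prod.snd h1
    have hs : speedSq g.toRiemannianMetric γ₁ 0 = 0 := by
      have hle := hlen 1 hone
      rw [h1, riemDist_prod_right, ← hb, ← hq] at hle
      have hle' := hle.trans_le (riemDist_le_arcLength_of_isGeodesicAt hε hg₂ hone)
      rw [arcLength_prod_of_isGeodesicAt g h hε hg₁ hg₂ hone,
        arcLength_eq_of_isGeodesicAt hε hg₂ hone, mul_one, mul_one,
        ENNReal.ofReal_le_ofReal_iff (Real.sqrt_nonneg _), add_comm] at hle'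
      exact eq_zero_of_sqrt_add_le (speedSq_nonneg _ _ _) (speedSq_nonneg _ _ _) hle'
    refine ⟨eq_zero_of_speedSq_eq_zero hv₁ hs,
      ⟨γ₂, ε, hε, hg₂, hv₂, hq, fun t ht => le_antisymm ?_ ?_⟩⟩
    · have hle := (hlen t ht).trans_le (riemDist_prod_le _ _ _ _)
      rw [arcLength_prod_of_isGeodesicAt g h hε hg₁ hg₂ ht, hs, zero_add,
        ← arcLength_eq_of_isGeodesicAt hε hg₂ ht, ← ha] at hle
      refine hle.trans ((add_le_add_left
        (riemDist_le_arcLength_of_isGeodesicAt hε hg₁ ht) _).trans_eq ?_)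
      simp [arcLength_eq_of_isGeodesicAt hε hg₁ ht, hs]
    · rw [← hb]
      exact riemDist_le_arcLength_of_isGeodesicAt hε hg₂ ht
  · rintro ⟨hv₁, ⟨γ, ε, hε, hγ, hv, h1, hlen⟩⟩
    have h0 : (0 : ℝ) ∈ Ioo (-ε) (1 + ε) := ⟨by linarith, by linarith⟩
    refine ⟨fun s => (a, γ s), ε, hε,
      fun t ht => (isGeodesicAt_prod_iff g h).2 ⟨isGeodesicAt_const _ a t, hγ t ht⟩, ?_, ?_, ?_⟩
    · refine (velocity_prod_eq_iff (γ₁ := fun _ => a) mdifferentiableAt_const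
        (hγ 0 h0).mdifferentiableAt).2 ⟨?_, hv⟩
      rw [mfderiv_const_curve, hv₁]
      rfl
    · exact congrArg (fun r => (a, r)) h1
    · intro t ht
      rw [arcLength_const_prod _ _ a fun r hr =>
        (hγ r ⟨by linarith [hr.1], hr.2.trans_lt ht.2⟩).mdifferentiableAt, riemDist_prod_right]
      exact hlen t ht

theorem riemLog_prod_left {a p : M} (b : N) (hp : p ∈ logDomain g.toRiemannianMetric a) :
    riemLog (prodMetric g.toRiemannianMetric h.toRiemannianMetric) (a, b) (p, b) =
      ((riemLog g.toRiemannianMetric a p, 0) : TangentSpace I a × TangentSpace J b) :=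
  riemLog_eq_of_isLog_iff fun u => (isLog_prod_left_iff g h a p b u).trans
    ((and_congr_left' (isLog_iff_eq_riemLog hp _)).trans
      (Prod.ext_iff (x := (u : E × E')) (y := (riemLog g.toRiemannianMetric a p, 0))).symm)

theorem riemLog_prod_right (a : M) {b q : N} (hq : q ∈ logDomain h.toRiemannianMetric b) :
    riemLog (prodMetric g.toRiemannianMetric h.toRiemannianMetric) (a, b) (a, q) =
      ((0, riemLog h.toRiemannianMetric b q) : TangentSpace I a × TangentSpace J b) :=
  riemLog_eq_of_isLog_iff fun u => (isLog_prod_right_iff g h a b q u).trans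
    ((and_congr_right' (isLog_iff_eq_riemLog hq _)).trans
      (Prod.ext_iff (x := (u : E × E')) (y := (0, riemLog h.toRiemannianMetric b q))).symm)

theorem mem_logDomain_self (a : M) : a ∈ logDomain g.toRiemannianMetric a :=
  ⟨0, (isLog_self_iff g a 0).2 rfl, fun u hu => (isLog_self_iff g a u).1 hu⟩

/-! ### Coordinates and covariances at the means. -/

variable {ι κ : Type*}

theorem logCoord_self {a : M} (β : Basis ι ℝ (TangentSpace I a)) :
    logCoord g.toRiemannianMetric β a = 0 := by
  ext i
  simp [logCoord, riemLog_self]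

theorem logCoord_prod_left {a p : M} (β : Basis ι ℝ (TangentSpace I a)) {b : N}
    (β' : Basis κ ℝ (TangentSpace J b)) (hp : p ∈ logDomain g.toRiemannianMetric a) :
    logCoord (prodMetric g.toRiemannianMetric h.toRiemannianMetric) (prodBasis β β') (p, b) =
      Sum.elim (logCoord g.toRiemannianMetric β p) 0 := by
  ext i
  rw [logCoord, riemLog_prod_left g h b hp]
  rcases i with i | j
  · exact Basis.prod_repr_inl β β' _ i
  · exact (Basis.prod_repr_inr β β' _ j).trans (by simp)

theorem logCoord_prod_right {a : M} (β : Basis ι ℝ (TangentSpace I a)) {b q : N}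
    (β' : Basis κ ℝ (TangentSpace J b)) (hq : q ∈ logDomain h.toRiemannianMetric b) :
    logCoord (prodMetric g.toRiemannianMetric h.toRiemannianMetric) (prodBasis β β') (a, q) =
      Sum.elim (0 : ι → ℝ) (logCoord h.toRiemannianMetric β' q) := by
  ext i
  rw [logCoord, riemLog_prod_right g h a hq]
  rcases i with i | j
  · exact (Basis.prod_repr_inl β β' _ i).trans (by simp)
  · exact Basis.prod_repr_inr β β' _ j

variable {Ω : Type*} [MeasurableSpace Ω] {P : Measure Ω} {X : Ω → M} {Y : Ω → N} {mX : M} {mY : N}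
  (β : Basis ι ℝ (TangentSpace I mX)) (β' : Basis κ ℝ (TangentSpace J mY))

/-- Almost surely the logarithm of `(X, mY)` has zero measurement part and the centring term
vanishes, so every entry outside the state block integrates zero. -/
theorem prodCovXX_at_means (hX : ∀ᵐ o ∂P, X o ∈ logDomain g.toRiemannianMetric mX) :
    prodCovXX g.toRiemannianMetric h.toRiemannianMetric β β' mY P X mX =
      Matrix.fromBlocks
        (crossCov g.toRiemannianMetric g.toRiemannianMetric β β P X mX X mX) 0 0 0 := by
  have hae : ∀ i j, (fun o =>
      (logCoord (prodMetric g.toRiemannianMetric h.toRiemannianMetric) (prodBasis β β') (X o, mY) -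
        logCoord (prodMetric g.toRiemannianMetric h.toRiemannianMetric) (prodBasis β β')
          (mX, mY)) i *
      (logCoord (prodMetric g.toRiemannianMetric h.toRiemannianMetric) (prodBasis β β') (X o, mY) -
        logCoord (prodMetric g.toRiemannianMetric h.toRiemannianMetric) (prodBasis β β')
          (mX, mY)) j) =ᵐ[P]
      fun o => Sum.elim (logCoord g.toRiemannianMetric β (X o)) 0 i *
        Sum.elim (logCoord g.toRiemannianMetric β (X o)) 0 j := by
    intro i j
    filter_upwards [hX] with o ho
    rw [logCoord_prod_left g h β β' ho, logCoord_prod_left g h β β' (mem_logDomain_self g mX),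
      logCoord_self]
    simp
  ext (i | i) (j | j) <;> refine (integral_congr_ae (hae _ _)).trans ?_ <;>
    simp [crossCov, logCoord_self]

theorem prodCovYY_at_means (hY : ∀ᵐ o ∂P, Y o ∈ logDomain h.toRiemannianMetric mY) :
    prodCovYY g.toRiemannianMetric h.toRiemannianMetric β β' mX P Y mY =
      Matrix.fromBlocks 0 0 0
        (crossCov h.toRiemannianMetric h.toRiemannianMetric β' β' P Y mY Y mY) := by
  have hae : ∀ i j, (fun o =>
      (logCoord (prodMetric g.toRiemannianMetric h.toRiemannianMetric) (prodBasis β β') (mX, Y o) -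
        logCoord (prodMetric g.toRiemannianMetric h.toRiemannianMetric) (prodBasis β β')
          (mX, mY)) i *
      (logCoord (prodMetric g.toRiemannianMetric h.toRiemannianMetric) (prodBasis β β') (mX, Y o) -
        logCoord (prodMetric g.toRiemannianMetric h.toRiemannianMetric) (prodBasis β β')
          (mX, mY)) j) =ᵐ[P]
      fun o => Sum.elim (0 : ι → ℝ) (logCoord h.toRiemannianMetric β' (Y o)) i *
        Sum.elim (0 : ι → ℝ) (logCoord h.toRiemannianMetric β' (Y o)) j := by
    intro i j
    filter_upwards [hY] with o ho
    rw [logCoord_prod_right g h β β' ho, logCoord_prod_right g h β β' (mem_logDomain_self h mY),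
      logCoord_self]
    simp
  ext (i | i) (j | j) <;> refine (integral_congr_ae (hae _ _)).trans ?_ <;>
    simp [crossCov, logCoord_self]

theorem prodCovXY_at_means (hX : ∀ᵐ o ∂P, X o ∈ logDomain g.toRiemannianMetric mX)
    (hY : ∀ᵐ o ∂P, Y o ∈ logDomain h.toRiemannianMetric mY) :
    prodCovXY g.toRiemannianMetric h.toRiemannianMetric β β' mX mY P X mX Y mY =
      Matrix.fromBlocks 0
        (crossCov g.toRiemannianMetric h.toRiemannianMetric β β' P X mX Y mY) 0 0 := by
  have hae : ∀ i j, (fun o =>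
      (logCoord (prodMetric g.toRiemannianMetric h.toRiemannianMetric) (prodBasis β β') (X o, mY) -
        logCoord (prodMetric g.toRiemannianMetric h.toRiemannianMetric) (prodBasis β β')
          (mX, mY)) i *
      (logCoord (prodMetric g.toRiemannianMetric h.toRiemannianMetric) (prodBasis β β') (mX, Y o) -
        logCoord (prodMetric g.toRiemannianMetric h.toRiemannianMetric) (prodBasis β β')
          (mX, mY)) j) =ᵐ[P]
      fun o => Sum.elim (logCoord g.toRiemannianMetric β (X o)) 0 i *
        Sum.elim (0 : ι → ℝ) (logCoord h.toRiemannianMetric β' (Y o)) j := by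
    intro i j
    filter_upwards [hX, hY] with o ho ho'
    rw [logCoord_prod_left g h β β' ho, logCoord_prod_right g h β β' ho',
      logCoord_prod_left g h β β' (mem_logDomain_self g mX), logCoord_self]
    simp
  ext (i | i) (j | j) <;> refine (integral_congr_ae (hae _ _)).trans ?_ <;>
    simp [crossCov, logCoord_self]

/-! ### Gain, mean and covariance of the correction in block form. -/

variable [Fintype ι] [Fintype κ] [DecidableEq κ]

theorem prodGain_at_means (hX : ∀ᵐ o ∂P, X o ∈ logDomain g.toRiemannianMetric mX)
    (hY : ∀ᵐ o ∂P, Y o ∈ logDomain h.toRiemannianMetric mY) :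
    prodGain g.toRiemannianMetric h.toRiemannianMetric β β' mX mY P X mX Y mY =
      Matrix.fromBlocks 0
        (crossCov g.toRiemannianMetric h.toRiemannianMetric β β' P X mX Y mY *
          (crossCov h.toRiemannianMetric h.toRiemannianMetric β' β' P Y mY Y mY)⁻¹) 0 0 := by
  rw [prodGain, prodCovXY_at_means g h β β' hX hY, Matrix.fromBlocks_multiply]
  simp

theorem prodCorrectedMean_at_means (hX : ∀ᵐ o ∂P, X o ∈ logDomain g.toRiemannianMetric mX)
    (hY : ∀ᵐ o ∂P, Y o ∈ logDomain h.toRiemannianMetric mY) {y : N}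
    (hy : y ∈ logDomain h.toRiemannianMetric mY) :
    prodCorrectedMean g.toRiemannianMetric h.toRiemannianMetric β β' mX mY P X mX Y mY y =
      Sum.elim ((crossCov g.toRiemannianMetric h.toRiemannianMetric β β' P X mX Y mY *
          (crossCov h.toRiemannianMetric h.toRiemannianMetric β' β' P Y mY Y mY)⁻¹) *ᵥ
        logCoord h.toRiemannianMetric β' y) 0 := by
  rw [prodCorrectedMean, prodGain_at_means g h β β' hX hY, logCoord_prod_right g h β β' hy,
    logCoord_prod_right g h β β' (mem_logDomain_self h mY), logCoord_self, Sum.elim_zero_zero,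
    sub_zero, zero_add, Matrix.fromBlocks_mulVec]
  simp

theorem prodCorrectedCov_at_means (hX : ∀ᵐ o ∂P, X o ∈ logDomain g.toRiemannianMetric mX)
    (hY : ∀ᵐ o ∂P, Y o ∈ logDomain h.toRiemannianMetric mY)
    {G : Matrix ι κ ℝ}
    (hG : G = crossCov g.toRiemannianMetric h.toRiemannianMetric β β' P X mX Y mY *
      (crossCov h.toRiemannianMetric h.toRiemannianMetric β' β' P Y mY Y mY)⁻¹) :
    prodCorrectedCov g.toRiemannianMetric h.toRiemannianMetric β β' mX mY P X mX Y mY =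
      Matrix.fromBlocks (crossCov g.toRiemannianMetric g.toRiemannianMetric β β P X mX X mX -
        G * crossCov h.toRiemannianMetric h.toRiemannianMetric β' β' P Y mY Y mY * Gᵀ) 0 0 0 := by
  -- The gain has only its upper right block, so multiplying it on both sides moves the measurement
  -- block of the covariance into the state block.
  rw [prodCorrectedCov, prodGain_at_means g h β β' hX hY, ← hG, prodCovXX_at_means g h β β' hX,
    prodCovYY_at_means g h β β' hY, Matrix.fromBlocks_transpose, Matrix.fromBlocks_multiply,
    Matrix.fromBlocks_multiply]
  ext (i | i) (j | j) <;> simp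

end Two

end RiemannianKalman

end

/-! ### The correction at the means. -/

theorem mainTheorem3 {nx ny : ℕ}
    {Nx : Type*} [TopologicalSpace Nx] [T2Space Nx] [ChartedSpace (EuclideanSpace ℝ (Fin nx)) Nx]
    [IsManifold (𝓡 nx) ∞ Nx] [MeasurableSpace Nx] [BorelSpace Nx]
    {Ny : Type*} [TopologicalSpace Ny] [T2Space Ny] [ChartedSpace (EuclideanSpace ℝ (Fin ny)) Ny]
    [IsManifold (𝓡 ny) ∞ Ny] [MeasurableSpace Ny] [BorelSpace Ny]
    -- the Riemannian metrics
    (gx : ContMDiffRiemannianMetric (𝓡 nx) ∞ (EuclideanSpace ℝ (Fin nx))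
      (fun p : Nx => TangentSpace (𝓡 nx) p))
    (gy : ContMDiffRiemannianMetric (𝓡 ny) ∞ (EuclideanSpace ℝ (Fin ny))
      (fun q : Ny => TangentSpace (𝓡 ny) q))
    -- the predicted state and the predicted measurement, with their means
    {Ω : Type*} [MeasurableSpace Ω] (P : Measure Ω) [IsProbabilityMeasure P]
    (X : Ω → Nx) (hX : Measurable X) (Y : Ω → Ny) (hY : Measurable Y)
    (xhat : Nx) (hxhat : RiemannianKalman.IsMean gx.toRiemannianMetric P X xhat)
    (yhat : Ny) (hyhat : RiemannianKalman.IsMean gy.toRiemannianMetric P Y yhat)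
    -- the acquired measurement
    (y : Ny)
    -- the logarithms are defined
    (hXlog : ∀ᵐ o ∂P, X o ∈ RiemannianKalman.logDomain gx.toRiemannianMetric xhat)
    (hYlog : ∀ᵐ o ∂P, Y o ∈ RiemannianKalman.logDomain gy.toRiemannianMetric yhat)
    (hylog : y ∈ RiemannianKalman.logDomain gy.toRiemannianMetric yhat)
    -- coordinates in the tangent spaces at the base points
    (β : Module.Basis (Fin nx) ℝ (TangentSpace (𝓡 nx) xhat))
    (β' : Module.Basis (Fin ny) ℝ (TangentSpace (𝓡 ny) yhat))
    -- the second moments exist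
    (hX2 : ∀ i, MemLp (fun o => RiemannianKalman.logCoord gx.toRiemannianMetric β (X o) i) 2 P)
    (hY2 : ∀ j, MemLp (fun o => RiemannianKalman.logCoord gy.toRiemannianMetric β' (Y o) j) 2 P)
    -- the covariances at the means
    (Pxx : Matrix (Fin nx) (Fin nx) ℝ)
    (hPxx : Pxx = RiemannianKalman.crossCov gx.toRiemannianMetric gx.toRiemannianMetric β β P
      X xhat X xhat)
    (Pxy : Matrix (Fin nx) (Fin ny) ℝ)
    (hPxy : Pxy = RiemannianKalman.crossCov gx.toRiemannianMetric gy.toRiemannianMetric β β' P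
      X xhat Y yhat)
    (Pyy : Matrix (Fin ny) (Fin ny) ℝ)
    (hPyy : Pyy = RiemannianKalman.crossCov gy.toRiemannianMetric gy.toRiemannianMetric β' β' P
      Y yhat Y yhat)
    (hPyy_inv : IsUnit Pyy.det)
    -- the gain
    (G : Matrix (Fin nx) (Fin ny) ℝ) (hG : G = Pxy * Pyy⁻¹) :
    RiemannianKalman.prodGain gx.toRiemannianMetric gy.toRiemannianMetric β β' xhat yhat P
        X xhat Y yhat = Matrix.fromBlocks 0 G 0 0 ∧
    RiemannianKalman.prodCorrectedMean gx.toRiemannianMetric gy.toRiemannianMetric β β' xhat yhat P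
        X xhat Y yhat y =
      Sum.elim (G *ᵥ RiemannianKalman.logCoord gy.toRiemannianMetric β' y) 0 ∧
    RiemannianKalman.correctedTangentState gx.toRiemannianMetric gy.toRiemannianMetric β β' xhat yhat
        P X xhat Y yhat y =
      G *ᵥ RiemannianKalman.logCoord gy.toRiemannianMetric β' y ∧
    RiemannianKalman.correctedTangentState gx.toRiemannianMetric gy.toRiemannianMetric β β' xhat yhat
        P X xhat Y yhat y =
      G *ᵥ (RiemannianKalman.logCoord gy.toRiemannianMetric β' y -
        RiemannianKalman.logCoord gy.toRiemannianMetric β' yhat) ∧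
    RiemannianKalman.prodCorrectedCov gx.toRiemannianMetric gy.toRiemannianMetric β β' xhat yhat P
        X xhat Y yhat = Matrix.fromBlocks (Pxx - G * Pyy * Gᵀ) 0 0 0 ∧
    RiemannianKalman.correctedTangentCov gx.toRiemannianMetric gy.toRiemannianMetric β β' xhat yhat P
        X xhat Y yhat = Pxx - G * Pyy * Gᵀ := by
  subst hPxx hPxy hPyy
  have hmean := RiemannianKalman.prodCorrectedMean_at_means gx gy β β' hXlog hYlog hylog
  have hcov := RiemannianKalman.prodCorrectedCov_at_means gx gy β β' hXlog hYlog hG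
  rw [← hG] at hmean
  have hstate : RiemannianKalman.correctedTangentState gx.toRiemannianMetric gy.toRiemannianMetric
      β β' xhat yhat P X xhat Y yhat y =
      G *ᵥ RiemannianKalman.logCoord gy.toRiemannianMetric β' y :=
    funext fun i => congrFun hmean (Sum.inl i)
  refine ⟨?_, hmean, hstate, ?_, hcov, ?_⟩
  · rw [RiemannianKalman.prodGain_at_means gx gy β β' hXlog hYlog, hG]
  · rw [hstate, RiemannianKalman.logCoord_self gy β', sub_zero]
  · rw [RiemannianKalman.correctedTangentCov, hcov, Matrix.toBlocks_fromBlocks₁₁]
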